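/- Let $M$ be a closed connected Riemannian spin manifold of dimension $4$ with Dirac operator $\slashed\partial=-i\gamma^\mu\nabla_\mu$, and let $\slashed D=\slashed\partial\otimes\mathbb I_{32}$ on $L^2(M,S)\otimes\mathbb C^{32}$. Write the $128$ indices as $(s,\dot s)$ (spinor: chirality $s=r,l$ and $\dot s$), $C$ (particle/antiparticle), $I=0,1,2,3$ (lepto-colour) and $\alpha=\dot1,\dot2,1,2$ (flavour). Let $\mathcal A=\big(C^\infty(M)\otimes(\mathbb C\oplus\mathbb H\oplus M_3(\mathbb C))\big)\otimes\mathbb C^2$. An element $a=(c,c',q,q',m,m')$ of $\mathcal A$ acts as $a=\mathrm{diag}(Q,M)$ in the index $C$, trivially in $\dot s$ and block-diagonally in $s=r,l$: $Q$ is trivial in $I$ and its blocks are $Q_r=\mathrm{diag}(c,\bar c,q')$, $Q_l=\mathrm{diag}(c',\bar c',q)$ in the flavour index; $M$ has the blocks $M_r=\mathrm{diag}(\mathbf m\otimes\mathbb I_2,\mathbf m'\otimes\mathbb I_2)$, $M_l=\mathrm{diag}(\mathbf m'\otimes\mathbb I_2,\mathbf m\otimes\mathbb I_2)$ in the flavour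 index, where $\mathbf m=\mathrm{diag}(c,m)$, $\mathbf m'=\mathrm{diag}(c',m')$ in the index $I$. The twist is $\rho(c,c',q,q',m,m')=(c',c,q',q,m',m)$, and $[\slashed D,b]_\rho=\slashed D b-\rho(b)\slashed D$. A free $1$-form is an operator $\slashed A=\sum_i a_i[\slashed D,b_i]_\rho$ (finite sum, $a_i,b_i\in\mathcal A$). It has the form $\slashed A=-i\gamma^\mu A_\mu$ with $A_\mu=\mathrm{diag}(Q_\mu,M_\mu)$, where $Q_\mu$ has the chirality blocks $Q^r_\mu=\mathrm{diag}(c^r_\mu,\bar c^r_\mu,q^r_\mu)$, $Q^l_\mu=\mathrm{diag}(c^l_\mu,\bar c^l_\mu,q^l_\mu)$ and $M_\mu$ has the chirality blocks $M^r_\mu=\mathrm{diag}(\mathbf m^r_\mu\otimes\mathbb I_2,\mathbf m^l_\mu\otimes\mathbb I_2)$, $M^l_\mu=\mathrm{diag}(\mathbf m^l_\mu\otimes\mathbb I_2,\mathbf m^r_\mu\otimes\mathbb I_2)$, with $\mathbf m^{r}_\mu=\mathrm{diag}(c^{r}_\mu,m^{r}_\mu)$, $\mathbf m^{l}_\mu=\mathrm{diag}(c^{l}_\mu,m^{l}_\mu)$;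 here $c^{r},c^{l}$, $q^{r},q^{l}$, $m^{r},m^{l}$ are $1$-forms with values in $\mathbb C$, $\mathbb H$, $M_3(\mathbb C)$. It is unimodular if $\mathrm{Tr}\,A_\mu=0$. A unitary $u$ of $\mathcal A$ acts by $\slashed A\mapsto\slashed A^u=\rho(u)\big([\slashed D,u^*]_\rho+\slashed A u^*\big)$. Let $u=(e^{i\alpha},e^{i\alpha'},\mathsf q,\mathsf q',\mathsf m,\mathsf m')$ with smooth $\alpha,\alpha':M\to\mathbb R$, $\mathsf q,\mathsf q':M\to SU(2)\subset\mathbb H$ and $\mathsf m,\mathsf m':M\to U(3)$. Then: 1. $\slashed A^u$ is selfadjoint for every unimodular selfadjoint free $1$-form $\slashed A$ if and only if the two halves of $u$ agree up to central constants: there are constants $K,\theta\in\mathbb R$ and $\varepsilon\in\{1,-1\}$ with $$\alpha'=\alpha+K,\qquad \mathsf q'=\varepsilon\,\mathsf q,\qquad \mathsf m'=e^{i\theta}\,\mathsf m .$$ 2. In that case the constants $\varepsilon,\theta$ do not affect the action: $\slashed A^u=\slashed A^v$ for every free $1$-form $\slashed A$, where $v=(e^{i\alpha},e^{i\alpha'},\mathsf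 q,\mathsf q,\mathsf m,\mathsf m)$ with $\alpha'=\alpha+K$. 3. In that case the components of every unimodular selfadjoint free $1$-form $\slashed A$ transform under $\slashed A\mapsto\slashed A^u$ as $$c^r_\mu\to c^r_\mu-i\partial_\mu\alpha,\qquad c^l_\mu\to c^l_\mu-i\partial_\mu\alpha,$$ $$q^r_\mu\to\mathsf q\,q^r_\mu\,\mathsf q^\dagger+\mathsf q(\partial_\mu\mathsf q^\dagger),\qquad q^l_\mu\to\mathsf q\,q^l_\mu\,\mathsf q^\dagger+\mathsf q(\partial_\mu\mathsf q^\dagger),$$ $$m^r_\mu\to\mathsf m\,m^r_\mu\,\mathsf m^\dagger+\mathsf m(\partial_\mu\mathsf m^\dagger),\qquad m^l_\mu\to\mathsf m\,m^l_\mu\,\mathsf m^\dagger+\mathsf m(\partial_\mu\mathsf m^\dagger).$$ -/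

import Mathlib

open scoped Manifold ContDiff Matrix Kronecker Quaternion
open MeasureTheory

noncomputable section

namespace TwistedSM

/-! ## Indices and Dirac matrices -/

/-- Index of a Dirac spinor: the pair `(s, ṡ)`, with `s = 0` for `r` and `s = 1` for `l`. -/
abbrev SpinIdx : Type := Fin 2 × Fin 2

/-- Flavour index `α`: `Sum.inl` for the dotted (right) values, `Sum.inr` for the undotted ones. -/
abbrev FlavourIdx : Type := Fin 2 ⊕ Fin 2

/-- Lepto-colour index `I`: `Sum.inl ()` for `I = 0`, `Sum.inr i` for the three colours. -/
abbrev ColourIdx : Type := Unit ⊕ Fin 3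

/-- Index `(C, I, α)` of the internal space `ℂ³²`; the outer sum is particle / antiparticle. -/
abbrev InternalIdx : Type := (ColourIdx × FlavourIdx) ⊕ (ColourIdx × FlavourIdx)

/-- Index of the 128 components of an element of `L²(M, S) ⊗ ℂ³²`. -/
abbrev Idx : Type := SpinIdx × InternalIdx

/-- The fibre `ℂ¹²⁸`. -/
abbrev Fibre : Type := Idx → ℂ

/-- `σ^μ = (1, -iσ₁, -iσ₂, -iσ₃)`. -/
def sigmaUp : Fin 4 → Matrix (Fin 2) (Fin 2) ℂ :=
  ![1,
    (-Complex.I) • !![0, 1; 1, 0],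
    (-Complex.I) • !![0, -Complex.I; Complex.I, 0],
    (-Complex.I) • !![1, 0; 0, -1]]

/-- `σ̃^μ = (1, iσ₁, iσ₂, iσ₃)`. -/
def sigmaTilde : Fin 4 → Matrix (Fin 2) (Fin 2) ℂ :=
  ![1,
    Complex.I • !![0, 1; 1, 0],
    Complex.I • !![0, -Complex.I; Complex.I, 0],
    Complex.I • !![1, 0; 0, -1]]

/-- The Euclidean Dirac matrices `γ^μ = [[0, σ^μ], [σ̃^μ, 0]]` in the chiral index `s`. -/
def gam (a : Fin 4) : Matrix SpinIdx SpinIdx ℂ :=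
  !![0, 1; 0, 0] ⊗ₖ sigmaUp a + !![0, 0; 1, 0] ⊗ₖ sigmaTilde a


/-- `diag(A, B)` on spinors: the element `(A, B)` of `Spin(4) = SU(2) × SU(2)` acting on `ℂ⁴`. -/
def spinMatrix (S : Matrix.specialUnitaryGroup (Fin 2) ℂ × Matrix.specialUnitaryGroup (Fin 2) ℂ) :
    Matrix SpinIdx SpinIdx ℂ :=
  !![1, 0; 0, 0] ⊗ₖ (S.1 : Matrix (Fin 2) (Fin 2) ℂ) +
    !![0, 0; 0, 1] ⊗ₖ (S.2 : Matrix (Fin 2) (Fin 2) ℂ)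

/-! ## The algebra and its representation -/

/-- `A_SM = ℂ ⊕ ℍ ⊕ M₃(ℂ)`. -/
abbrev ASM : Type := ℂ × ℍ[ℝ] × Matrix (Fin 3) (Fin 3) ℂ

/-- The usual representation of quaternions, `[[z, w], [-w̄, z̄]]`. -/
def quatMatrix (q : ℍ[ℝ]) : Matrix (Fin 2) (Fin 2) ℂ :=
  !![⟨q.re, q.imI⟩, ⟨q.imJ, q.imK⟩; ⟨-q.imJ, q.imK⟩, ⟨q.re, -q.imI⟩]

/-- `diag(c, c̄, q)` in the flavour index. -/
def flavourBlock (c : ℂ) (q : ℍ[ℝ]) : Matrix FlavourIdx FlavourIdx ℂ :=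
  Matrix.fromBlocks (Matrix.diagonal ![c, star c]) 0 0 (quatMatrix q)

/-- `diag(c, m)` in the lepto-colour index. -/
def colourBlock (c : ℂ) (m : Matrix (Fin 3) (Fin 3) ℂ) : Matrix ColourIdx ColourIdx ℂ :=
  Matrix.fromBlocks (Matrix.of fun _ _ => c) 0 0 m

/-- One chirality block: `Q = δ_I^J diag(c, c̄, q)` on particles, and, on antiparticles,
`M = diag(m₁ ⊗ 1₂, m₂ ⊗ 1₂)` in the flavour index. -/
def chiralBlock (c : ℂ) (q : ℍ[ℝ]) (m₁ m₂ : Matrix ColourIdx ColourIdx ℂ) :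
    Matrix InternalIdx InternalIdx ℂ :=
  Matrix.fromBlocks ((1 : Matrix ColourIdx ColourIdx ℂ) ⊗ₖ flavourBlock c q) 0 0
    (Matrix.blockDiagonal (Sum.elim (fun _ : Fin 2 => m₁) (fun _ : Fin 2 => m₂)))

/-- The `128 × 128` matrix, trivial in `ṡ`, whose chirality blocks are
`Q_r = diag(c_r, c̄_r, q_r)`, `Q_l = diag(c_l, c̄_l, q_l)` on particles and
`M_r = diag(m_r ⊗ 1₂, m_l ⊗ 1₂)`, `M_l = diag(m_l ⊗ 1₂, m_r ⊗ 1₂)` on antiparticles, where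
`m_r`, `m_l` here stand for `diag(c_r, m_r)`, `diag(c_l, m_l)` in the lepto-colour index. -/
def blockRep (cr cl : ℂ) (qr ql : ℍ[ℝ]) (mr ml : Matrix (Fin 3) (Fin 3) ℂ) :
    Matrix Idx Idx ℂ :=
  ((!![1, 0; 0, 0] : Matrix (Fin 2) (Fin 2) ℂ) ⊗ₖ (1 : Matrix (Fin 2) (Fin 2) ℂ)) ⊗ₖ
      chiralBlock cr qr (colourBlock cr mr) (colourBlock cl ml) +
    ((!![0, 0; 0, 1] : Matrix (Fin 2) (Fin 2) ℂ) ⊗ₖ (1 : Matrix (Fin 2) (Fin 2) ℂ)) ⊗ₖ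
      chiralBlock cl ql (colourBlock cl ml) (colourBlock cr mr)

/-- Representation of `((c, q, m), (c', q', m'))`: the right block contains `c, q'`, the left
block `c', q`. -/
def rep (a : ASM × ASM) : Matrix Idx Idx ℂ :=
  blockRep a.1.1 a.2.1 a.2.2.1 a.1.2.1 a.1.2.2 a.2.2.2

/-! ## Geometry -/

/-- Model space of the manifold. -/
abbrev E4 : Type := EuclideanSpace ℝ (Fin 4)

variable {M : Type*} [TopologicalSpace M] [ChartedSpace E4 M] [IsManifold (𝓡 4) ∞ M]

/-- Smooth Riemannian metrics on `M`. -/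
abbrev Metric4 (M : Type*) [TopologicalSpace M] [ChartedSpace E4 M] [IsManifold (𝓡 4) ∞ M] :=
  Bundle.ContMDiffRiemannianMetric (𝓡 4) ∞ E4 (fun x : M => TangentSpace (𝓡 4) x)

/-- Derivative `∂_v f` at `x` of a vector-valued function. -/
def dAlong {V : Type*} [NormedAddCommGroup V] [NormedSpace ℝ V] (f : M → V) (x : M)
    (v : TangentSpace (𝓡 4) x) : V :=
  mfderiv (𝓡 4) 𝓘(ℝ, V) f x v

/-- Entrywise derivative `∂_v f` at `x` of a matrix-valued function. -/
def dMatrix (f : M → Matrix (Fin 3) (Fin 3) ℂ) (x : M) (v : TangentSpace (𝓡 4) x) :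
    Matrix (Fin 3) (Fin 3) ℂ :=
  Matrix.of fun i j => dAlong (fun y => f y i j) x v

/-- The matrix of `v` under Clifford multiplication in the orthonormal frame `e`:
`Σ_a g(v, e_a) γ^a`. -/
def cliffordMatrix (g : Metric4 M) (e : Fin 4 → (x : M) → TangentSpace (𝓡 4) x) (x : M)
    (v : TangentSpace (𝓡 4) x) : Matrix SpinIdx SpinIdx ℂ :=
  ∑ a, ((g.inner x v (e a x) : ℝ) : ℂ) • gam a

/-- A spin structure on `(M, g)`: an open cover, orthonormal frames on its members, and a lift to
`Spin(4)` of the transition functions of the frames that satisfies the cocycle condition.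
For every point one member of the cover that contains it is singled out. -/
structure SpinStructure (g : Metric4 M) where
  /-- index set of the cover -/
  ι : Type
  /-- the members of the cover -/
  U : ι → Set M
  isOpen_U : ∀ i, IsOpen (U i)
  /-- a member of the cover that contains the point -/
  at' : M → ι
  mem_U : ∀ x, x ∈ U (at' x)
  /-- the frames (with irrelevant values outside `U i`) -/
  e : ι → Fin 4 → (x : M) → TangentSpace (𝓡 4) x
  smooth_e : ∀ i a, ContMDiffOn (𝓡 4) (𝓡 4).tangent ∞
    (fun x => (⟨x, e i a x⟩ : TangentBundle (𝓡 4) M)) (U i)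
  orthonormal : ∀ i, ∀ x ∈ U i, ∀ a b, g.inner x (e i a x) (e i b x) = if a = b then 1 else 0
  /-- the transition functions with values in `Spin(4)` -/
  S : ι → ι → M →
    Matrix.specialUnitaryGroup (Fin 2) ℂ × Matrix.specialUnitaryGroup (Fin 2) ℂ
  smooth_S : ∀ i j p p',
    ContMDiffOn (𝓡 4) 𝓘(ℝ, ℂ) ∞ (fun x => spinMatrix (S i j x) p p') (U i ∩ U j)
  cocycle : ∀ i j k, ∀ x ∈ U i ∩ U j ∩ U k, S i j x * S j k x = S i k x
  covers : ∀ i j, ∀ x ∈ U i ∩ U j, ∀ v : TangentSpace (𝓡 4) x,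
    spinMatrix (S i j x) * cliffordMatrix g (e j) x v =
      cliffordMatrix g (e i) x v * spinMatrix (S i j x)

/-- `g(∇_{e_a} e_b, e_c)` for the Levi-Civita connection, by the Koszul formula in an orthonormal
frame. -/
def connCoeff (g : Metric4 M) (e : Fin 4 → (x : M) → TangentSpace (𝓡 4) x) (x : M)
    (a b c : Fin 4) : ℝ :=
  (g.inner x (VectorField.mlieBracket (𝓡 4) (e a) (e b) x) (e c x)
    - g.inner x (VectorField.mlieBracket (𝓡 4) (e b) (e c) x) (e a x)
    + g.inner x (VectorField.mlieBracket (𝓡 4) (e c) (e a) x) (e b x)) / 2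

/-- The spin connection in direction `e_a`: `-¼ Σ_{b,c} g(∇_{e_a} e_b, e_c) γ^b γ^c`. It is the
connection with `[ω_a, γ(e_b)] = γ(∇_{e_a} e_b)`. -/
def spinConn (g : Metric4 M) (e : Fin 4 → (x : M) → TangentSpace (𝓡 4) x) (x : M)
    (a : Fin 4) : Matrix SpinIdx SpinIdx ℂ :=
  (-(1 / 4) : ℂ) • ∑ b, ∑ c, ((connCoeff g e x a b c : ℝ) : ℂ) • (gam b * gam c)

/-- A spinor matrix acting on `ℂ⁴ ⊗ ℂ³²`. -/
def onSpin (A : Matrix SpinIdx SpinIdx ℂ) : Matrix Idx Idx ℂ :=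
  A ⊗ₖ (1 : Matrix InternalIdx InternalIdx ℂ)

section Spinors

variable {g : Metric4 M} (σ : SpinStructure g)

/-- A section `ψ` of `S ⊗ ℂ³²` is a function whose value at `x` is the column of components of the
section in the frame singled out at `x`. This is its column of components in the frame `i`. -/
def localRep (ψ : M → Fibre) (i : σ.ι) (x : M) : Fibre :=
  onSpin (spinMatrix (σ.S i (σ.at' x) x)) *ᵥ ψ x

/-- Smooth sections of `S ⊗ ℂ³²`. -/
def IsSmoothSection (ψ : M → Fibre) : Prop :=
  ∀ i, ContMDiffOn (𝓡 4) 𝓘(ℝ, Fibre) ∞ (localRep σ ψ i) (σ.U i)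

/-- Operators on sections; only their values on smooth sections matter. -/
abbrev SectionOp (M : Type*) : Type _ := (M → Fibre) → (M → Fibre)

/-- The free Dirac operator `D̸ = -i Σ_a γ^a ∇_{e_a} ⊗ 1`, with `∇ = d + ω`. -/
def dirac : SectionOp M := fun ψ x =>
  (-Complex.I) • ∑ a, onSpin (gam a) *ᵥ
    (dAlong (localRep σ ψ (σ.at' x)) x (σ.e (σ.at' x) a x)
      + onSpin (spinConn g (σ.e (σ.at' x)) x a) *ᵥ ψ x)

/-- Action of (a field of) elements of the algebra. The matrices commute with those of `Spin(4)`, so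
that this does not depend on the frame. -/
def act (a : M → ASM × ASM) : SectionOp M := fun ψ x => rep (a x) *ᵥ ψ x

/-- The twist, which exchanges the two copies of the algebra. -/
def twist (a : M → ASM × ASM) : M → ASM × ASM := fun x => (a x).swap

/-- Smooth fields of elements of `A_SM`. -/
def IsSmoothASM (a : M → ASM) : Prop :=
  ContMDiff (𝓡 4) 𝓘(ℝ, ℂ) ∞ (fun x => (a x).1) ∧
  ContMDiff (𝓡 4) 𝓘(ℝ, ℍ[ℝ]) ∞ (fun x => (a x).2.1) ∧
  ∀ i j, ContMDiff (𝓡 4) 𝓘(ℝ, ℂ) ∞ (fun x => (a x).2.2 i j)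

/-- The elements of the algebra `(C^∞(M) ⊗ A_SM) ⊗ ℂ²`. -/
def InAlg (a : M → ASM × ASM) : Prop :=
  IsSmoothASM (fun x => (a x).1) ∧ IsSmoothASM (fun x => (a x).2)

/-- The twisted commutator `[D̸, b]_ρ = D̸ b - ρ(b) D̸`. -/
def twistedComm (b : M → ASM × ASM) : SectionOp M := fun ψ =>
  dirac σ (act b ψ) - act (twist b) (dirac σ ψ)

/-- Free 1-forms: the operators `Σ_i a_i [D̸, b_i]_ρ`. -/
def IsFreeOneForm (A : SectionOp M) : Prop :=
  ∃ (n : ℕ) (a b : Fin n → M → ASM × ASM), (∀ k, InAlg (a k)) ∧ (∀ k, InAlg (b k)) ∧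
    ∀ ψ, IsSmoothSection σ ψ → A ψ = ∑ k, act (a k) (twistedComm σ (b k) ψ)

/-- The twisted gauge action `A ↦ A^u = ρ(u) ([D̸, u*]_ρ + A u*)`. -/
def gaugeAct (u : M → ASM × ASM) (A : SectionOp M) : SectionOp M := fun ψ =>
  act (twist u) (twistedComm σ (star u) ψ + A (act (star u) ψ))

/-- The fields `c^r, c^l, q^r, q^l, m^r, m^l` of a free 1-form, as 1-forms on `M`; the value at
`∂_μ` is the component with index `μ`. -/
structure Components (M : Type*) [TopologicalSpace M] [ChartedSpace E4 M] where
  cr : (x : M) → TangentSpace (𝓡 4) x →ₗ[ℝ] ℂ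
  cl : (x : M) → TangentSpace (𝓡 4) x →ₗ[ℝ] ℂ
  qr : (x : M) → TangentSpace (𝓡 4) x →ₗ[ℝ] ℍ[ℝ]
  ql : (x : M) → TangentSpace (𝓡 4) x →ₗ[ℝ] ℍ[ℝ]
  mr : (x : M) → TangentSpace (𝓡 4) x →ₗ[ℝ] Matrix (Fin 3) (Fin 3) ℂ
  ml : (x : M) → TangentSpace (𝓡 4) x →ₗ[ℝ] Matrix (Fin 3) (Fin 3) ℂ

/-- The matrix `A_μ = diag(Q_μ, M_μ)` with the given components, contracted with `v`. -/
def Components.matrix (w : Components M) (x : M) (v : TangentSpace (𝓡 4) x) : Matrix Idx Idx ℂ :=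
  blockRep (w.cr x v) (w.cl x v) (w.qr x v) (w.ql x v) (w.mr x v) (w.ml x v)

/-- `A = -i γ^μ A_μ`, where `A_μ` has the components `w`. -/
def HasComponents (A : SectionOp M) (w : Components M) : Prop :=
  ∀ ψ, IsSmoothSection σ ψ → ∀ x,
    A ψ x = (-Complex.I) • ∑ a, onSpin (gam a) *ᵥ
      (w.matrix x (σ.e (σ.at' x) a x) *ᵥ ψ x)

/-- Unimodularity: `A = -i γ^μ A_μ` with `Tr A_μ = 0`. -/
def IsUnimodular (A : SectionOp M) : Prop :=
  ∃ w : Components M, HasComponents σ A w ∧ ∀ x v, (w.matrix x v).trace = 0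

end Spinors

/-! ## Riemannian volume and selfadjointness -/

section Volume

variable [MeasurableSpace M] [BorelSpace M]

/-- The coordinate vector `∂_i` of the chart at `x₀`, at the point with coordinates `y`. -/
def coordVec (x₀ : M) (y : E4) (i : Fin 4) : TangentSpace (𝓡 4) ((extChartAt (𝓡 4) x₀).symm y) :=
  mfderiv 𝓘(ℝ, E4) (𝓡 4) (extChartAt (𝓡 4) x₀).symm y (EuclideanSpace.single i (1 : ℝ) : E4)

/-- `√(det g_{ij})` in the chart at `x₀`. -/
def volDensity (g : Metric4 M) (x₀ : M) (y : E4) : ℝ :=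
  Real.sqrt (Matrix.det (Matrix.of fun i j : Fin 4 =>
    g.inner ((extChartAt (𝓡 4) x₀).symm y) (coordVec x₀ y i) (coordVec x₀ y j)))

/-- The measure `√(det g) dy` on the domain of the chart at `x₀`. -/
def chartVolume (g : Metric4 M) (x₀ : M) : Measure M :=
  (((volume : Measure E4).restrict (extChartAt (𝓡 4) x₀).target).withDensity
    (fun y => ENNReal.ofReal (volDensity g x₀ y))).map (extChartAt (𝓡 4) x₀).symm

/-- There is a smooth partition of unity subordinate to the domains of the charts. -/
theorem exists_partition (M : Type*) [TopologicalSpace M] [ChartedSpace E4 M]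
    [IsManifold (𝓡 4) ∞ M] [CompactSpace M] [T2Space M] :
    ∃ f : SmoothPartitionOfUnity M (𝓡 4) M Set.univ,
      f.IsSubordinate (fun x => (chartAt E4 x).source) :=
  SmoothPartitionOfUnity.exists_isSubordinate (𝓡 4) isClosed_univ _
    (fun x => (chartAt E4 x).open_source)
    (fun x _ => Set.mem_iUnion.2 ⟨x, mem_chart_source E4 x⟩)

/-- The Riemannian volume measure: chart volumes glued by a partition of unity (the result does not
depend on the partition). -/
def riemannianVolume [CompactSpace M] [T2Space M] (g : Metric4 M) : Measure M :=
  Measure.sum fun x₀ : M => (chartVolume g x₀).withDensity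
    (fun x => ENNReal.ofReal ((exists_partition M).choose x₀ x))

variable [CompactSpace M] [T2Space M] {g : Metric4 M} (σ : SpinStructure g)

/-- The inner product of `L²(M, S) ⊗ ℂ³²`. -/
def innerL2 (_σ : SpinStructure g) (ψ χ : M → Fibre) : ℂ :=
  ∫ x, star (ψ x) ⬝ᵥ χ x ∂(riemannianVolume g)

/-- Selfadjointness of a bounded operator on `L²(M, S) ⊗ ℂ³²`, tested on the dense subspace of
smooth sections. -/
def IsSelfAdjointOp (A : SectionOp M) : Prop :=
  ∀ ψ χ, IsSmoothSection σ ψ → IsSmoothSection σ χ →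
    innerL2 σ (A ψ) χ = innerL2 σ ψ (A χ)

/-- The gauge action of `u` preserves selfadjointness of every unimodular selfadjoint free
1-form. -/
def PreservesSelfAdjointness (u : M → ASM × ASM) : Prop :=
  ∀ A : SectionOp M, IsFreeOneForm σ A → IsSelfAdjointOp σ A → IsUnimodular σ A →
    IsSelfAdjointOp σ (gaugeAct σ u A)

end Volume

/-- The unitary `u = (e^{iα}, e^{iα'}, q, q', m, m')`. -/
def unitaryElt (α α' : M → ℝ) (q q' : M → ℍ[ℝ]) (m m' : M → Matrix (Fin 3) (Fin 3) ℂ) :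
    M → ASM × ASM := fun x =>
  ((Complex.exp (Complex.I * α x), q x, m x), (Complex.exp (Complex.I * α' x), q' x, m' x))

end TwistedSM

end

/-! Write ρ for the twist, the exchange `Prod.swap` of the two halves, and suppress `rep`. Each γ^a
exchanges the chiralities, and the left block of an element is the right block of its twist, so b
γ^a = γ^a ρ(b). The spin connection contains two Dirac matrices and therefore commutes with b. Hence
[D̸, b]_ρ = -iγ^μ ∂_μ b (`twistedComm_eq`), a free 1-form is -iγ^μ η_μ with η = Σ ρ(a_k) db_k
(`sum_act_twistedComm`), and the twisted gauge action becomes the ordinary one, η ↦ u d(u*) + u η u*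
(`gaugeAct_eq`). The γ^a are independent over the algebra (`eq_zero_of_sum_gam_mul_rep`), so the
operator determines η. It is selfadjoint exactly when ρ(η) = -η*: symmetry of the integrals forces
symmetry at every point, by testing on bump sections (`isSkewForm_of_isSelfAdjointOp`).

Let u = (u₁, u₂) and θ = u d(u*); unitarity gives θ* = -θ. If selfadjointness is preserved, the form
η = 0 yields ρ(θ) = θ, that is u₁ d(u₁*) = u₂ d(u₂*), which makes u₁* u₂ constant (`swap_eq`,
`star_mul_eq`). The unimodular forms (-X*, X) dh with X = (0, q, m) and Tr m = 0 yield u₂ X u₂* = u₁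
X u₁*, so u₁* u₂ commutes with X (`commute`). Its quaternion part is then central and unitary, hence
±1, and its matrix part is a phase. In the abelian part, ρ(θ) = θ says dα' = dα.

Conversely, let u₂ = Z u₁ with Z constant, central and unitary. Then Z cancels in u d(u*) + u η u*,
and both halves of η are transformed by u₁ alone (`AgreesUpToCenter.gaugeForm_apply`). Preservation
of selfadjointness, irrelevance of ε and θ, and the transformation law are all read off from this
formula. -/

namespace TwistedSM

/-! ## Algebra of the representation -/

/-- The quaternion matrix is multiplicative. -/
theorem quatMatrix_mul (p q : ℍ[ℝ]) : quatMatrix (p * q) = quatMatrix p * quatMatrix q := by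
  ext i j
  fin_cases i <;> fin_cases j <;>
    simp [quatMatrix, Matrix.mul_apply, Fin.sum_univ_two, Complex.ext_iff] <;> constructor <;> ring

theorem quatMatrix_star (q : ℍ[ℝ]) : quatMatrix (star q) = (quatMatrix q)ᴴ := by
  ext i j
  fin_cases i <;> fin_cases j <;> simp [quatMatrix, Complex.ext_iff]

theorem quatMatrix_add (p q : ℍ[ℝ]) : quatMatrix (p + q) = quatMatrix p + quatMatrix q := by
  ext i j
  fin_cases i <;> fin_cases j <;> simp [quatMatrix, Complex.ext_iff] <;> ring

theorem quatMatrix_smul (r : ℝ) (q : ℍ[ℝ]) : quatMatrix (r • q) = r • quatMatrix q := by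
  ext i j
  fin_cases i <;> fin_cases j <;> simp [quatMatrix, Complex.ext_iff]

theorem quatMatrix_eq_zero {q : ℍ[ℝ]} (h : quatMatrix q = 0) : q = 0 := by
  have h0 := congrFun (congrFun h 0) 0
  have h1 := congrFun (congrFun h 0) 1
  simp [quatMatrix, Complex.ext_iff] at h0 h1
  ext
  exacts [h0.1, h0.2, h1.1, h1.2]

theorem flavourBlock_mul (c d : ℂ) (p q : ℍ[ℝ]) :
    flavourBlock (c * d) (p * q) = flavourBlock c p * flavourBlock d q := by
  simp only [flavourBlock, Matrix.fromBlocks_multiply, quatMatrix_mul, Matrix.zero_mul,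
    Matrix.mul_zero, add_zero, zero_add, Matrix.diagonal_mul_diagonal]
  congr 2
  ext i
  fin_cases i <;> simp

theorem flavourBlock_star (c : ℂ) (q : ℍ[ℝ]) :
    flavourBlock (star c) (star q) = (flavourBlock c q)ᴴ := by
  simp only [flavourBlock, Matrix.fromBlocks_conjTranspose, quatMatrix_star,
    Matrix.diagonal_conjTranspose, Matrix.conjTranspose_zero]
  congr 2
  ext i
  fin_cases i <;> simp

theorem flavourBlock_add (c d : ℂ) (p q : ℍ[ℝ]) :
    flavourBlock (c + d) (p + q) = flavourBlock c p + flavourBlock d q := by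
  simp only [flavourBlock, Matrix.fromBlocks_add, quatMatrix_add, add_zero,
    Matrix.diagonal_add]
  congr 2
  ext i
  fin_cases i <;> simp

theorem flavourBlock_smul (r : ℝ) (c : ℂ) (q : ℍ[ℝ]) :
    flavourBlock (r • c) (r • q) = r • flavourBlock c q := by
  simp only [flavourBlock, Matrix.fromBlocks_smul, quatMatrix_smul, smul_zero]
  congr 1
  ext i j
  fin_cases i <;> fin_cases j <;> simp

theorem colourBlock_mul (c d : ℂ) (m n : Matrix (Fin 3) (Fin 3) ℂ) :
    colourBlock (c * d) (m * n) = colourBlock c m * colourBlock d n := by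
  simp only [colourBlock, Matrix.fromBlocks_multiply, Matrix.zero_mul,
    Matrix.mul_zero, add_zero, zero_add]
  congr 1
  ext i j
  simp [Matrix.mul_apply]

theorem colourBlock_star (c : ℂ) (m : Matrix (Fin 3) (Fin 3) ℂ) :
    colourBlock (star c) (star m) = (colourBlock c m)ᴴ := by
  simp only [colourBlock, Matrix.fromBlocks_conjTranspose, Matrix.star_eq_conjTranspose,
    Matrix.conjTranspose_zero]
  congr 1

theorem colourBlock_add (c d : ℂ) (m n : Matrix (Fin 3) (Fin 3) ℂ) :
    colourBlock (c + d) (m + n) = colourBlock c m + colourBlock d n := by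
  simp only [colourBlock, Matrix.fromBlocks_add, add_zero]
  congr 1

theorem colourBlock_smul (r : ℝ) (c : ℂ) (m : Matrix (Fin 3) (Fin 3) ℂ) :
    colourBlock (r • c) (r • m) = r • colourBlock c m := by
  simp only [colourBlock, Matrix.fromBlocks_smul, smul_zero]
  congr 1

theorem colourBlock_eq_zero {c : ℂ} {m : Matrix (Fin 3) (Fin 3) ℂ} (h : colourBlock c m = 0) :
    c = 0 ∧ m = 0 := by
  rw [colourBlock, ← Matrix.fromBlocks_zero, Matrix.fromBlocks_inj] at h
  exact ⟨congrFun (congrFun h.1 ()) (), h.2.2.2⟩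

theorem chiralBlock_mul (c d : ℂ) (p q : ℍ[ℝ]) (m₁ m₂ n₁ n₂ : Matrix ColourIdx ColourIdx ℂ) :
    chiralBlock (c * d) (p * q) (m₁ * n₁) (m₂ * n₂) =
      chiralBlock c p m₁ m₂ * chiralBlock d q n₁ n₂ := by
  simp only [chiralBlock, Matrix.fromBlocks_multiply, Matrix.zero_mul,
    Matrix.mul_zero, add_zero, zero_add, flavourBlock_mul, ← Matrix.mul_kronecker_mul,
    Matrix.one_mul, ← Matrix.blockDiagonal_mul]
  congr 2
  ext (i | i) <;> rfl

theorem chiralBlock_star (c : ℂ) (q : ℍ[ℝ]) (m₁ m₂ : Matrix ColourIdx ColourIdx ℂ) :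
    chiralBlock (star c) (star q) m₁ᴴ m₂ᴴ = (chiralBlock c q m₁ m₂)ᴴ := by
  simp only [chiralBlock, Matrix.fromBlocks_conjTranspose, flavourBlock_star,
    Matrix.conjTranspose_zero, Matrix.conjTranspose_kronecker, Matrix.conjTranspose_one,
    Matrix.blockDiagonal_conjTranspose]
  congr 2
  ext (i | i) <;> rfl

theorem chiralBlock_add (c d : ℂ) (p q : ℍ[ℝ]) (m₁ m₂ n₁ n₂ : Matrix ColourIdx ColourIdx ℂ) :
    chiralBlock (c + d) (p + q) (m₁ + n₁) (m₂ + n₂) =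
      chiralBlock c p m₁ m₂ + chiralBlock d q n₁ n₂ := by
  simp only [chiralBlock, Matrix.fromBlocks_add, add_zero, flavourBlock_add,
    Matrix.kronecker_add, ← Matrix.blockDiagonal_add]
  congr 2
  ext (i | i) <;> rfl

theorem chiralBlock_smul (r : ℝ) (c : ℂ) (q : ℍ[ℝ]) (m₁ m₂ : Matrix ColourIdx ColourIdx ℂ) :
    chiralBlock (r • c) (r • q) (r • m₁) (r • m₂) = r • chiralBlock c q m₁ m₂ := by
  simp only [chiralBlock, Matrix.fromBlocks_smul, flavourBlock_smul, smul_zero,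
    Matrix.kronecker_smul, ← Matrix.blockDiagonal_smul]
  congr 2
  ext (i | i) <;> rfl

theorem chiralBlock_eq_zero {c : ℂ} {q : ℍ[ℝ]} {m₁ m₂ : Matrix ColourIdx ColourIdx ℂ}
    (h : chiralBlock c q m₁ m₂ = 0) : q = 0 ∧ m₁ = 0 ∧ m₂ = 0 := by
  rw [chiralBlock, ← Matrix.fromBlocks_zero, Matrix.fromBlocks_inj] at h
  obtain ⟨h₁, -, -, h₂⟩ := h
  refine ⟨quatMatrix_eq_zero ?_, ?_, ?_⟩
  · ext i j
    simpa [flavourBlock] using congrFun (congrFun h₁ (Sum.inl (), Sum.inr i)) (Sum.inl (), Sum.inr j)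
  · ext i j
    simpa using congrFun (congrFun h₂ (i, Sum.inl 0)) (j, Sum.inl 0)
  · ext i j
    simpa using congrFun (congrFun h₂ (i, Sum.inr 0)) (j, Sum.inr 0)

theorem zero_fin_two : (!![0, 0; 0, 0] : Matrix (Fin 2) (Fin 2) ℂ) = 0 := by
  ext i j; fin_cases i <;> fin_cases j <;> simp

/-- The right chirality block of the representation. -/
noncomputable def rightBlock (a : ASM × ASM) : Matrix InternalIdx InternalIdx ℂ :=
  chiralBlock a.1.1 a.2.2.1 (colourBlock a.1.1 a.1.2.2) (colourBlock a.2.1 a.2.2.2)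

/-- The left chirality block of the representation is the right one of the twisted element. -/
theorem rep_eq (a : ASM × ASM) : rep a =
    ((!![1, 0; 0, 0] : Matrix (Fin 2) (Fin 2) ℂ) ⊗ₖ (1 : Matrix (Fin 2) (Fin 2) ℂ)) ⊗ₖ
      rightBlock a +
    ((!![0, 0; 0, 1] : Matrix (Fin 2) (Fin 2) ℂ) ⊗ₖ (1 : Matrix (Fin 2) (Fin 2) ℂ)) ⊗ₖ
      rightBlock a.swap := rfl

theorem rightBlock_mul (a b : ASM × ASM) : rightBlock (a * b) = rightBlock a * rightBlock b := by
  simp only [rightBlock, ← chiralBlock_mul, ← colourBlock_mul]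
  rfl

theorem rightBlock_star (a : ASM × ASM) : rightBlock (star a) = (rightBlock a)ᴴ := by
  simp only [rightBlock, ← chiralBlock_star, ← colourBlock_star]
  rfl

theorem rightBlock_add (a b : ASM × ASM) : rightBlock (a + b) = rightBlock a + rightBlock b := by
  simp only [rightBlock, ← chiralBlock_add, ← colourBlock_add]
  rfl

theorem rightBlock_smul (r : ℝ) (a : ASM × ASM) : rightBlock (r • a) = r • rightBlock a := by
  simp only [rightBlock, ← chiralBlock_smul, ← colourBlock_smul]
  rfl

/-- One chirality block contains both complex numbers and both colour matrices but only one of the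
two quaternions, so the block of the twisted element is needed for the other. -/
theorem eq_zero_of_rightBlock {a : ASM × ASM} (h : rightBlock a = 0) (h' : rightBlock a.swap = 0) :
    a = 0 := by
  obtain ⟨hq, h₁, h₂⟩ := chiralBlock_eq_zero h
  obtain ⟨hq', -, -⟩ := chiralBlock_eq_zero h'
  obtain ⟨hc, hm⟩ := colourBlock_eq_zero h₁
  obtain ⟨hc', hm'⟩ := colourBlock_eq_zero h₂
  exact Prod.ext (Prod.ext hc (Prod.ext hq' hm)) (Prod.ext hc' (Prod.ext hq hm'))

theorem rep_mul (a b : ASM × ASM) : rep (a * b) = rep a * rep b := by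
  have hs : (a * b).swap = a.swap * b.swap := rfl
  simp only [rep_eq, hs, rightBlock_mul, Matrix.add_mul, Matrix.mul_add,
    ← Matrix.mul_kronecker_mul, Matrix.mul_fin_two, mul_zero, mul_one, add_zero, zero_add,
    zero_fin_two, Matrix.zero_kronecker]

theorem rep_star (a : ASM × ASM) : rep (star a) = (rep a)ᴴ := by
  have hs : (star a).swap = star a.swap := rfl
  have e₁ : (!![1, 0; 0, 0] : Matrix (Fin 2) (Fin 2) ℂ)ᴴ = !![1, 0; 0, 0] := by
    ext i j; fin_cases i <;> fin_cases j <;> simp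
  have e₂ : (!![0, 0; 0, 1] : Matrix (Fin 2) (Fin 2) ℂ)ᴴ = !![0, 0; 0, 1] := by
    ext i j; fin_cases i <;> fin_cases j <;> simp
  simp only [rep_eq, hs, rightBlock_star, Matrix.conjTranspose_add, Matrix.conjTranspose_kronecker,
    Matrix.conjTranspose_one, e₁, e₂]

theorem diag_add_diag :
    (!![1, 0; 0, 0] : Matrix (Fin 2) (Fin 2) ℂ) + !![0, 0; 0, 1] = 1 := by
  ext i j; fin_cases i <;> fin_cases j <;> simp

theorem rep_add (a b : ASM × ASM) : rep (a + b) = rep a + rep b := by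
  have hs : (a + b).swap = a.swap + b.swap := rfl
  simp only [rep_eq, hs, rightBlock_add, Matrix.kronecker_add]
  abel

theorem rep_smul (r : ℝ) (a : ASM × ASM) : rep (r • a) = r • rep a := by
  have hs : (r • a).swap = r • a.swap := rfl
  simp only [rep_eq, hs, rightBlock_smul, Matrix.kronecker_smul, smul_add]

/-- The representation as a real linear map. -/
noncomputable def repₗ : ASM × ASM →ₗ[ℝ] Matrix Idx Idx ℂ where
  toFun := rep
  map_add' := rep_add
  map_smul' := rep_smul

theorem rep_zero : rep 0 = 0 := map_zero repₗ

theorem rep_neg (a : ASM × ASM) : rep (-a) = -rep a := map_neg repₗ a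

theorem rep_sub (a b : ASM × ASM) : rep (a - b) = rep a - rep b := map_sub repₗ a b

theorem rep_sum {κ : Type*} (s : Finset κ) (f : κ → ASM × ASM) :
    rep (∑ k ∈ s, f k) = ∑ k ∈ s, rep (f k) := map_sum repₗ f s

/-! ## Dirac matrices and spin matrices -/

theorem onSpin_mul (A B : Matrix SpinIdx SpinIdx ℂ) : onSpin (A * B) = onSpin A * onSpin B := by
  simp only [onSpin, ← Matrix.mul_kronecker_mul, Matrix.one_mul]

theorem onSpin_one : onSpin 1 = 1 := by
  simp only [onSpin, Matrix.one_kronecker_one]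

theorem onSpin_add (A B : Matrix SpinIdx SpinIdx ℂ) : onSpin (A + B) = onSpin A + onSpin B := by
  simp only [onSpin, Matrix.add_kronecker]

theorem onSpin_zero : onSpin 0 = 0 := by
  simp only [onSpin, Matrix.zero_kronecker]

theorem onSpin_smul (c : ℂ) (A : Matrix SpinIdx SpinIdx ℂ) : onSpin (c • A) = c • onSpin A := by
  simp only [onSpin, Matrix.smul_kronecker]

theorem onSpin_sum {κ : Type*} (s : Finset κ) (f : κ → Matrix SpinIdx SpinIdx ℂ) :
    onSpin (∑ k ∈ s, f k) = ∑ k ∈ s, onSpin (f k) := by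
  classical
  induction s using Finset.induction_on with
  | empty => simp [onSpin_zero]
  | insert a s ha ih => rw [Finset.sum_insert ha, Finset.sum_insert ha, onSpin_add, ih]

theorem onSpin_conjTranspose (A : Matrix SpinIdx SpinIdx ℂ) : onSpin Aᴴ = (onSpin A)ᴴ := by
  simp only [onSpin, Matrix.conjTranspose_kronecker, Matrix.conjTranspose_one]

theorem sigmaTilde_eq (a : Fin 4) : sigmaTilde a = (sigmaUp a)ᴴ := by
  fin_cases a <;> ext i j <;> fin_cases i <;> fin_cases j <;>
    simp [sigmaTilde, sigmaUp]

theorem gam_conjTranspose (a : Fin 4) : (gam a)ᴴ = gam a := by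
  have e₁ : (!![0, 1; 0, 0] : Matrix (Fin 2) (Fin 2) ℂ)ᴴ = !![0, 0; 1, 0] := by
    ext i j; fin_cases i <;> fin_cases j <;> simp
  have e₂ : (!![0, 0; 1, 0] : Matrix (Fin 2) (Fin 2) ℂ)ᴴ = !![0, 1; 0, 0] := by
    ext i j; fin_cases i <;> fin_cases j <;> simp
  simp only [gam, Matrix.conjTranspose_add, Matrix.conjTranspose_kronecker, e₁, e₂, sigmaTilde_eq,
    Matrix.conjTranspose_conjTranspose]
  rw [add_comm]

theorem onSpin_gam_mul_rep (a : Fin 4) (b : ASM × ASM) : onSpin (gam a) * rep b =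
    (!![0, 0; 1, 0] ⊗ₖ sigmaTilde a) ⊗ₖ rightBlock b +
      (!![0, 1; 0, 0] ⊗ₖ sigmaUp a) ⊗ₖ rightBlock b.swap := by
  simp only [onSpin, gam, rep_eq, Matrix.mul_add, ← Matrix.mul_kronecker_mul, Matrix.add_mul,
    Matrix.mul_fin_two, mul_zero, mul_one, one_mul, add_zero, zero_add,
    zero_fin_two, Matrix.zero_kronecker, Matrix.add_kronecker]

/-- The Dirac matrices intertwine the representation with the twisted one. -/
theorem rep_mul_onSpin_gam (a : Fin 4) (b : ASM × ASM) :
    rep b * onSpin (gam a) = onSpin (gam a) * rep b.swap := by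
  rw [onSpin_gam_mul_rep]
  simp only [onSpin, gam, rep_eq, Matrix.mul_add, ← Matrix.mul_kronecker_mul, Matrix.add_mul,
    Prod.swap_swap, Matrix.mul_fin_two, mul_zero, mul_one, one_mul, add_zero, zero_add,
    zero_fin_two, Matrix.zero_kronecker, Matrix.add_kronecker]
  rw [add_comm]

/-- Spin matrices preserve chirality and act on `ṡ` only, where the algebra acts trivially. This
makes the action of the algebra independent of the frame. -/
theorem rep_mul_onSpin_spinMatrix (b : ASM × ASM)
    (S : Matrix.specialUnitaryGroup (Fin 2) ℂ × Matrix.specialUnitaryGroup (Fin 2) ℂ) :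
    rep b * onSpin (spinMatrix S) = onSpin (spinMatrix S) * rep b := by
  simp only [onSpin, spinMatrix, rep_eq, Matrix.mul_add, ← Matrix.mul_kronecker_mul,
    Matrix.add_mul, Matrix.mul_fin_two, mul_zero, mul_one, one_mul, add_zero, zero_add,
    zero_fin_two, Matrix.zero_kronecker, Matrix.add_kronecker]

theorem spinMatrix_mul
    (S T : Matrix.specialUnitaryGroup (Fin 2) ℂ × Matrix.specialUnitaryGroup (Fin 2) ℂ) :
    spinMatrix (S * T) = spinMatrix S * spinMatrix T := by
  simp only [spinMatrix, Matrix.mul_add, ← Matrix.mul_kronecker_mul, Matrix.add_mul,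
    Matrix.mul_fin_two, mul_zero, mul_one, add_zero, zero_add,
    zero_fin_two, Matrix.zero_kronecker]
  rfl

theorem spinMatrix_one : spinMatrix 1 = 1 := by
  simp only [spinMatrix, Prod.fst_one, Prod.snd_one, Submonoid.coe_one, ← Matrix.add_kronecker,
    diag_add_diag, Matrix.one_kronecker_one]

theorem spinMatrix_star_mul
    (S : Matrix.specialUnitaryGroup (Fin 2) ℂ × Matrix.specialUnitaryGroup (Fin 2) ℂ) :
    (spinMatrix S)ᴴ * spinMatrix S = 1 := by
  have h₁ : (S.1 : Matrix (Fin 2) (Fin 2) ℂ)ᴴ * S.1 = 1 :=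
    (Matrix.mem_unitaryGroup_iff').1 (Matrix.mem_specialUnitaryGroup_iff.1 S.1.2).1
  have h₂ : (S.2 : Matrix (Fin 2) (Fin 2) ℂ)ᴴ * S.2 = 1 :=
    (Matrix.mem_unitaryGroup_iff').1 (Matrix.mem_specialUnitaryGroup_iff.1 S.2.2).1
  have e₁ : (!![1, 0; 0, 0] : Matrix (Fin 2) (Fin 2) ℂ)ᴴ = !![1, 0; 0, 0] := by
    ext i j; fin_cases i <;> fin_cases j <;> simp
  have e₂ : (!![0, 0; 0, 1] : Matrix (Fin 2) (Fin 2) ℂ)ᴴ = !![0, 0; 0, 1] := by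
    ext i j; fin_cases i <;> fin_cases j <;> simp
  simp only [spinMatrix, Matrix.conjTranspose_add, Matrix.conjTranspose_kronecker, e₁, e₂,
    Matrix.mul_add, ← Matrix.mul_kronecker_mul, Matrix.add_mul, h₁, h₂,
    Matrix.mul_fin_two, mul_zero, mul_one, add_zero, zero_add,
    zero_fin_two, Matrix.zero_kronecker]
  rw [← Matrix.add_kronecker, diag_add_diag, Matrix.one_kronecker_one]

/-- The matrices `γ^a` are linearly independent over the representation. -/
theorem eq_zero_of_sum_gam_mul_rep (ξ : Fin 4 → ASM × ASM)
    (h : ∑ a, onSpin (gam a) * rep (ξ a) = 0) (a : Fin 4) : ξ a = 0 := by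
  simp only [onSpin_gam_mul_rep, Fin.sum_univ_four] at h
  have key : ∀ I J, ∀ a, rightBlock (ξ a) I J = 0 ∧ rightBlock (ξ a).swap I J = 0 := by
    intro I J
    have H := fun s t p q => congrFun (congrFun h ((s, p), I)) ((t, q), J)
    -- In a fixed internal entry, the lower left chirality block combines the σ̃^a with the right
    -- blocks, and the upper right one combines the σ^a with the twisted right blocks. The sums and
    -- differences below isolate each coefficient in the basis 1, σ₁, σ₂, σ₃.
    have a1 := H 1 0 0 0
    have a2 := H 1 0 0 1
    have a3 := H 1 0 1 0
    have a4 := H 1 0 1 1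
    have b1 := H 0 1 0 0
    have b2 := H 0 1 0 1
    have b3 := H 0 1 1 0
    have b4 := H 0 1 1 1
    simp [sigmaUp, sigmaTilde] at a1 a2 a3 a4 b1 b2 b3 b4
    have z : ∀ {x : ℂ}, 2 * x = 0 → x = 0 := fun h => by simpa using h
    have z' : ∀ {x : ℂ}, 2 * (Complex.I * x) = 0 → x = 0 := fun h => by simpa using h
    have c0 : rightBlock (ξ 0) I J = 0 := z (by linear_combination a1 + a4)
    have d0 : rightBlock (ξ 0).swap I J = 0 := z (by linear_combination b1 + b4)
    have c1 : rightBlock (ξ 1) I J = 0 := z' (by linear_combination a2 + a3)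
    have d1 : rightBlock (ξ 1).swap I J = 0 := z' (by linear_combination -b2 - b3)
    have c2 : rightBlock (ξ 2) I J = 0 := z (by linear_combination a2 - a3)
    have d2 : rightBlock (ξ 2).swap I J = 0 := z (by linear_combination b3 - b2)
    have c3 : rightBlock (ξ 3) I J = 0 := z' (by linear_combination a1 - a4)
    have d3 : rightBlock (ξ 3).swap I J = 0 := z' (by linear_combination b4 - b1)
    intro a
    fin_cases a
    exacts [⟨c0, d0⟩, ⟨c1, d1⟩, ⟨c2, d2⟩, ⟨c3, d3⟩]
  refine eq_zero_of_rightBlock ?_ ?_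
  · ext I J; exact (key I J a).1
  · ext I J; exact (key I J a).2

theorem trace_quatMatrix (q : ℍ[ℝ]) : (quatMatrix q).trace = 2 * (q.re : ℂ) := by
  simp [Matrix.trace, quatMatrix, Complex.ext_iff]
  ring

theorem trace_rightBlock (a : ASM × ASM) : (rightBlock a).trace =
    4 * (a.1.1 + star a.1.1 + 2 * (a.2.2.1.re : ℂ)) +
      2 * (a.1.1 + a.1.2.2.trace) + 2 * (a.2.1 + a.2.2.2.trace) := by
  have h := trace_quatMatrix a.2.2.1
  simp only [Matrix.trace, Matrix.diag, Fin.sum_univ_two] at h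
  simp [rightBlock, chiralBlock, Matrix.trace, flavourBlock, colourBlock, Fintype.sum_sum_type,
    Fintype.sum_prod_type, Finset.sum_add_distrib, ← Finset.mul_sum]
  linear_combination 4 * h

theorem trace_rep (a : ASM × ASM) : (rep a).trace =
    2 * (rightBlock a).trace + 2 * (rightBlock a.swap).trace := by
  simp only [rep_eq, Matrix.trace_add, Matrix.trace_kronecker]
  simp [Matrix.trace, Fin.sum_univ_two]

/-! ## Derivatives on the manifold -/

section Derivative

variable {M : Type*} [TopologicalSpace M] [ChartedSpace E4 M]
  {V W U : Type*} [NormedAddCommGroup V] [NormedSpace ℝ V] [NormedAddCommGroup W] [NormedSpace ℝ W]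
  [NormedAddCommGroup U] [NormedSpace ℝ U]

theorem dAlong_linearMap [FiniteDimensional ℝ V] (L : V →ₗ[ℝ] W) {f : M → V} {x : M}
    (hf : MDifferentiableAt (𝓡 4) 𝓘(ℝ, V) f x) (v : TangentSpace (𝓡 4) x) :
    dAlong (fun y => L (f y)) x v = L (dAlong f x v) := by
  have h := (L.toContinuousLinearMap.hasFDerivAt (x := f x)).hasMFDerivAt.comp x hf.hasMFDerivAt
  exact congrArg (fun T => T v) h.mfderiv

theorem contMDiff_linearMap [FiniteDimensional ℝ V] (L : V →ₗ[ℝ] W) {f : M → V}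
    (hf : ContMDiff (𝓡 4) 𝓘(ℝ, V) ∞ f) : ContMDiff (𝓡 4) 𝓘(ℝ, W) ∞ (fun y => L (f y)) :=
  L.toContinuousLinearMap.contDiff.contMDiff.comp hf

theorem hasMFDerivAt_bilinear [FiniteDimensional ℝ V] [FiniteDimensional ℝ W]
    (B : V →ₗ[ℝ] W →ₗ[ℝ] U) {f : M → V} {h : M → W} {x : M}
    (hf : MDifferentiableAt (𝓡 4) 𝓘(ℝ, V) f x) (hh : MDifferentiableAt (𝓡 4) 𝓘(ℝ, W) h x) :
    HasMFDerivAt (𝓡 4) 𝓘(ℝ, U) (fun y => B (f y) (h y)) x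
      ((B.toContinuousBilinearMap.isBoundedBilinearMap.deriv (f x, h x)).comp
        ((mfderiv (𝓡 4) 𝓘(ℝ, V) f x).prod (mfderiv (𝓡 4) 𝓘(ℝ, W) h x))) :=
  ((B.toContinuousBilinearMap.isBoundedBilinearMap.hasFDerivAt (f x, h x)).hasMFDerivAt).comp x
    ⟨hf.hasMFDerivAt.1.prodMk hh.hasMFDerivAt.1, hf.hasMFDerivAt.2.prodMk hh.hasMFDerivAt.2⟩

/-- A general bilinear map is used so that one Leibniz rule serves both the product of the algebra
and its action on the fibre. -/
theorem dAlong_bilinear [FiniteDimensional ℝ V] [FiniteDimensional ℝ W]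
    (B : V →ₗ[ℝ] W →ₗ[ℝ] U) {f : M → V} {h : M → W} {x : M}
    (hf : MDifferentiableAt (𝓡 4) 𝓘(ℝ, V) f x) (hh : MDifferentiableAt (𝓡 4) 𝓘(ℝ, W) h x)
    (v : TangentSpace (𝓡 4) x) :
    dAlong (fun y => B (f y) (h y)) x v = B (f x) (dAlong h x v) + B (dAlong f x v) (h x) :=
  congrArg (fun T => T v) (hasMFDerivAt_bilinear B hf hh).mfderiv

theorem contMDiffOn_bilinear [FiniteDimensional ℝ V] [FiniteDimensional ℝ W]
    (B : V →ₗ[ℝ] W →ₗ[ℝ] U) {f : M → V} {h : M → W} {s : Set M}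
    (hf : ContMDiffOn (𝓡 4) 𝓘(ℝ, V) ∞ f s) (hh : ContMDiffOn (𝓡 4) 𝓘(ℝ, W) ∞ h s) :
    ContMDiffOn (𝓡 4) 𝓘(ℝ, U) ∞ (fun y => B (f y) (h y)) s :=
  (B.toContinuousBilinearMap.isBoundedBilinearMap.contDiff.contMDiff.comp_contMDiffOn
    (hf.prodMk_space hh))

theorem dAlong_congr {f h : M → V} {x : M} (hfh : f =ᶠ[nhds x] h) (v : TangentSpace (𝓡 4) x) :
    dAlong f x v = dAlong h x v := by
  rw [dAlong, hfh.mfderiv_eq]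
  rfl

theorem dAlong_const (c : V) (x : M) (v : TangentSpace (𝓡 4) x) :
    dAlong (fun _ : M => c) x v = 0 := by
  simp only [dAlong, mfderiv_const]
  rfl

variable [IsManifold (𝓡 4) ∞ M]

/-- A function on a connected manifold whose derivative vanishes is constant. -/
theorem eq_of_dAlong_eq_zero [PreconnectedSpace M] {f : M → V}
    (hf : ContMDiff (𝓡 4) 𝓘(ℝ, V) ∞ f) (h : ∀ x v, dAlong f x v = 0) (x y : M) : f x = f y := by
  have hl : IsLocallyConstant f := by
    rw [IsLocallyConstant.iff_eventually_eq]
    intro x₀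
    set φ := extChartAt (𝓡 4) x₀ with hφ
    have ht : IsOpen φ.target := isOpen_extChartAt_target x₀
    have hd : ∀ z ∈ φ.target, HasFDerivAt (f ∘ φ.symm) (0 : E4 →L[ℝ] V) z := by
      intro z hz
      have h₁ : MDifferentiableAt 𝓘(ℝ, E4) (𝓡 4) φ.symm z :=
        ((contMDiffOn_extChartAt_symm (n := ∞) (I := 𝓡 4) x₀).contMDiffAt
          (ht.mem_nhds hz)).mdifferentiableAt (by simp)
      have h₂ : HasMFDerivAt (𝓡 4) 𝓘(ℝ, V) f (φ.symm z) 0 := by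
        have h₃ := ((hf (φ.symm z)).mdifferentiableAt (by simp)).hasMFDerivAt
        have h₄ : mfderiv (𝓡 4) 𝓘(ℝ, V) f (φ.symm z) = 0 := by
          ext v
          exact h _ v
        rwa [h₄] at h₃
      have h₅ := (h₂.comp z h₁.hasMFDerivAt).hasFDerivAt
      refine h₅.congr_fderiv ?_
      ext v
      rfl
    -- A ball in the image of the chart is convex, so the vanishing derivative makes the function
    -- constant on it.
    obtain ⟨r, hr, hb⟩ := Metric.isOpen_iff.1 ht (φ x₀) (mem_extChartAt_target x₀)
    have hc : ∀ z ∈ Metric.ball (φ x₀) r, (f ∘ φ.symm) z = (f ∘ φ.symm) (φ x₀) := by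
      intro z hz
      refine (convex_ball (φ x₀) r).is_const_of_fderivWithin_eq_zero (𝕜 := ℝ) ?_ ?_ hz
        (Metric.mem_ball_self hr)
      · exact fun w hw => (hd w (hb hw)).differentiableAt.differentiableWithinAt
      · intro w hw
        rw [fderivWithin_of_isOpen Metric.isOpen_ball hw, (hd w (hb hw)).fderiv]
    have hn : ∀ᶠ y in nhds x₀, φ y ∈ Metric.ball (φ x₀) r :=
      (continuousAt_extChartAt x₀).eventually (Metric.ball_mem_nhds _ hr)
    filter_upwards [hn, extChartAt_source_mem_nhds (I := 𝓡 4) x₀] with y hy hs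
    have := hc _ hy
    rwa [Function.comp_apply, Function.comp_apply, φ.left_inv hs,
      φ.left_inv (mem_extChartAt_source x₀)] at this
  exact hl.apply_eq_of_preconnectedSpace x y

/-- Every point has a smooth real function with nonzero derivative there. -/
theorem exists_dAlong_ne_zero [T2Space M] (x₀ : M) :
    ∃ h : M → ℝ, ContMDiff (𝓡 4) 𝓘(ℝ, ℝ) ∞ h ∧ ∃ v, dAlong h x₀ v ≠ 0 := by
  let f : SmoothBumpFunction (𝓡 4) x₀ := Classical.arbitrary _
  let L : E4 →ₗ[ℝ] ℝ := (EuclideanSpace.proj (0 : Fin 4) : E4 →L[ℝ] ℝ).toLinearMap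
  have hφ : ContMDiffOn (𝓡 4) 𝓘(ℝ, E4) ∞ (extChartAt (𝓡 4) x₀) (chartAt E4 x₀).source :=
    contMDiffOn_extChartAt
  have hd : MDifferentiableAt (𝓡 4) 𝓘(ℝ, E4) (extChartAt (𝓡 4) x₀) x₀ :=
    mdifferentiableAt_extChartAt (mem_chart_source E4 x₀)
  -- The first chart coordinate, cut off by a bump function; the latter is 1 near `x₀` and leaves
  -- the derivative there unchanged.
  refine ⟨fun y => f y • L (extChartAt (𝓡 4) x₀ y), f.contMDiff_smul ?_, ?_⟩
  · exact L.toContinuousLinearMap.contDiff.contMDiff.comp_contMDiffOn hφ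
  · have hi := isInvertible_mfderiv_extChartAt (I := 𝓡 4) (mem_extChartAt_source (I := 𝓡 4) x₀)
    obtain ⟨e, he⟩ := hi
    -- The derivative of the chart is invertible, so some tangent vector is mapped to the first
    -- basis vector.
    refine ⟨e.symm (EuclideanSpace.single 0 1 : E4), ?_⟩
    rw [dAlong_congr (h := fun y => L (extChartAt (𝓡 4) x₀ y)), dAlong_linearMap L hd]
    · have : dAlong (extChartAt (𝓡 4) x₀) x₀ (e.symm (EuclideanSpace.single 0 1 : E4)) =
          (EuclideanSpace.single 0 1 : E4) := by
        rw [dAlong, ← he]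
        exact e.apply_symm_apply _
      rw [this]
      simp [L]
    · filter_upwards [f.eventuallyEq_one] with y hy
      simp [hy]

/-- Derivatives of smooth functions along smooth vector fields are continuous. -/
theorem continuousOn_dAlong {f : M → V} (hf : ContMDiff (𝓡 4) 𝓘(ℝ, V) ∞ f)
    {X : (x : M) → TangentSpace (𝓡 4) x} {s : Set M}
    (hX : ContinuousOn (fun x => (⟨x, X x⟩ : TangentBundle (𝓡 4) M)) s) :
    ContinuousOn (fun x => dAlong f x (X x)) s := by
  have h₁ : Continuous (tangentMap (𝓡 4) 𝓘(ℝ, V) f) := hf.continuous_tangentMap (by simp)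
  have h₂ := h₁.comp_continuousOn hX
  have h₃ : Continuous (fun p : TangentBundle 𝓘(ℝ, V) V => p.2) :=
    continuous_snd.comp (tangentBundleModelSpaceHomeomorph 𝓘(ℝ, V)).continuous
  exact h₃.comp_continuousOn h₂

end Derivative

/-! ## Differential of fields of algebra elements -/

section Differential

variable {M : Type*} [TopologicalSpace M] [ChartedSpace E4 M]

/-- A normed space isomorphic to `A_SM`. -/
abbrev ASMCoord : Type := ℂ × ℍ[ℝ] × (Fin 3 → Fin 3 → ℂ)

/-- Coordinates on the algebra, with values in a normed space. -/
noncomputable def coord : (ASM × ASM) ≃ₗ[ℝ] (ASMCoord × ASMCoord) :=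
  let e : ASM ≃ₗ[ℝ] ASMCoord := LinearEquiv.prodCongr (LinearEquiv.refl ℝ ℂ)
    (LinearEquiv.prodCongr (LinearEquiv.refl ℝ ℍ[ℝ]) (Matrix.ofLinearEquiv ℝ).symm)
  LinearEquiv.prodCongr e e

/-- One-forms on `M` with values in the algebra `A_SM ⊗ ℂ²`. -/
abbrev OneForm (M : Type*) [TopologicalSpace M] [ChartedSpace E4 M] : Type _ :=
  (x : M) → TangentSpace (𝓡 4) x →ₗ[ℝ] ASM × ASM

/-- The differential of a field of elements of the algebra. -/
noncomputable def dForm (b : M → ASM × ASM) : OneForm M := fun x =>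
  coord.symm.toLinearMap ∘ₗ
    (mfderiv (𝓡 4) 𝓘(ℝ, ASMCoord × ASMCoord) (fun y => coord (b y)) x).toLinearMap

theorem dForm_apply (b : M → ASM × ASM) (x : M) (v : TangentSpace (𝓡 4) x) :
    dForm b x v = coord.symm (dAlong (fun y => coord (b y)) x v) := rfl

theorem contMDiff_prod {V W : Type*} [NormedAddCommGroup V] [NormedSpace ℝ V]
    [NormedAddCommGroup W] [NormedSpace ℝ W] {b : M → V × W} :
    ContMDiff (𝓡 4) 𝓘(ℝ, V × W) ∞ b ↔
      ContMDiff (𝓡 4) 𝓘(ℝ, V) ∞ (fun x => (b x).1) ∧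
        ContMDiff (𝓡 4) 𝓘(ℝ, W) ∞ (fun x => (b x).2) :=
  ⟨fun h => ⟨contDiff_fst.contMDiff.comp h, contDiff_snd.contMDiff.comp h⟩,
    fun h => h.1.prodMk_space h.2⟩

/-- Smoothness is imposed entry by entry; this turns it into smoothness of one map to a normed
space, where the chain rule and the Leibniz rule apply. -/
theorem inAlg_iff {b : M → ASM × ASM} :
    InAlg b ↔ ContMDiff (𝓡 4) 𝓘(ℝ, ASMCoord × ASMCoord) ∞ (fun y => coord (b y)) := by
  simp only [InAlg, IsSmoothASM, contMDiff_prod, contMDiff_pi_space]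
  rfl

theorem InAlg.mdifferentiableAt {b : M → ASM × ASM} (hb : InAlg b) (x : M) :
    MDifferentiableAt (𝓡 4) 𝓘(ℝ, ASMCoord × ASMCoord) (fun y => coord (b y)) x :=
  (inAlg_iff.1 hb x).mdifferentiableAt (by simp)

theorem InAlg.mul {a b : M → ASM × ASM} (ha : InAlg a) (hb : InAlg b) : InAlg (a * b) := by
  rw [inAlg_iff] at *
  rw [← contMDiffOn_univ] at *
  refine (contMDiffOn_bilinear (((LinearMap.mul ℝ (ASM × ASM)).compl₁₂ coord.symm.toLinearMap
    coord.symm.toLinearMap).compr₂ coord.toLinearMap) ha hb).congr fun y _ => ?_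
  simp

/-- The involution of the algebra as a real linear map. -/
noncomputable def starₗ : ASM × ASM →ₗ[ℝ] ASM × ASM where
  toFun := star
  map_add' := star_add
  map_smul' := fun r a => by
    ext <;> simp

theorem InAlg.star {b : M → ASM × ASM} (hb : InAlg b) : InAlg (star b) := by
  rw [inAlg_iff] at *
  have h := contMDiff_linearMap (coord.toLinearMap ∘ₗ starₗ ∘ₗ coord.symm.toLinearMap) hb
  simp only [LinearMap.comp_apply, LinearEquiv.coe_coe, LinearEquiv.symm_apply_apply] at h
  exact h

theorem inAlg_const (c : ASM × ASM) : InAlg (fun _ : M => c) :=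
  inAlg_iff.2 contMDiff_const

theorem dForm_const (c : ASM × ASM) (x : M) (v : TangentSpace (𝓡 4) x) :
    dForm (fun _ : M => c) x v = 0 := by
  rw [dForm_apply, dAlong_const, map_zero]

/-- Linear maps commute with the differential. -/
theorem map_dForm {V : Type*} [NormedAddCommGroup V] [NormedSpace ℝ V]
    (L : ASM × ASM →ₗ[ℝ] V) {b : M → ASM × ASM} (hb : InAlg b) (x : M)
    (v : TangentSpace (𝓡 4) x) : L (dForm b x v) = dAlong (fun y => L (b y)) x v := by
  have h := dAlong_linearMap (L ∘ₗ coord.symm.toLinearMap) (hb.mdifferentiableAt x) v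
  simp only [LinearMap.comp_apply, LinearEquiv.coe_coe, LinearEquiv.symm_apply_apply] at h
  exact h.symm

/-- Applied below to the involution, to the exchange of the halves, and to maps that depend on one
half only. -/
theorem dForm_linearMap (L : ASM × ASM →ₗ[ℝ] ASM × ASM) {b : M → ASM × ASM} (hb : InAlg b) (x : M)
    (v : TangentSpace (𝓡 4) x) : dForm (fun y => L (b y)) x v = L (dForm b x v) := by
  have h := map_dForm (coord.toLinearMap ∘ₗ L) hb x v
  rw [dForm_apply, LinearEquiv.symm_apply_eq]
  exact h.symm

theorem dForm_star {b : M → ASM × ASM} (hb : InAlg b) (x : M) (v : TangentSpace (𝓡 4) x) :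
    dForm (star b) x v = star (dForm b x v) :=
  dForm_linearMap starₗ hb x v

theorem dForm_mul {a b : M → ASM × ASM} (ha : InAlg a) (hb : InAlg b) (x : M)
    (v : TangentSpace (𝓡 4) x) :
    dForm (a * b) x v = a x * dForm b x v + dForm a x v * b x := by
  have h := dAlong_bilinear (((LinearMap.mul ℝ (ASM × ASM)).compl₁₂ coord.symm.toLinearMap
    coord.symm.toLinearMap).compr₂ coord.toLinearMap) (ha.mdifferentiableAt x)
    (hb.mdifferentiableAt x) v
  simp only [LinearMap.compr₂_apply, LinearMap.compl₁₂_apply, LinearEquiv.coe_coe,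
    LinearEquiv.symm_apply_apply, LinearMap.mul_apply'] at h
  rw [dForm_apply, LinearEquiv.symm_apply_eq, map_add]
  exact h

theorem eq_of_dForm_eq_zero [IsManifold (𝓡 4) ∞ M] [PreconnectedSpace M] {b : M → ASM × ASM}
    (hb : InAlg b) (h : ∀ x v, dForm b x v = 0) (x y : M) : b x = b y :=
  coord.injective (eq_of_dAlong_eq_zero (inAlg_iff.1 hb)
    (fun x v => coord.symm.injective ((h x v).trans (map_zero _).symm)) x y)

/-- The action of the algebra on the fibre. -/
noncomputable def repBilin : ASM × ASM →ₗ[ℝ] Fibre →ₗ[ℝ] Fibre :=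
  LinearMap.mk₂ ℝ (fun b ψ => rep b *ᵥ ψ)
    (fun a b ψ => by rw [rep_add, Matrix.add_mulVec])
    (fun r b ψ => by rw [rep_smul, Matrix.smul_mulVec])
    (fun b ψ χ => Matrix.mulVec_add _ _ _)
    (fun r b ψ => Matrix.mulVec_smul _ _ _)

theorem repBilin_apply (b : ASM × ASM) (ψ : Fibre) : repBilin b ψ = rep b *ᵥ ψ := rfl

theorem dAlong_rep_mulVec {b : M → ASM × ASM} (hb : InAlg b) {φ : M → Fibre} {x : M}
    (hφ : MDifferentiableAt (𝓡 4) 𝓘(ℝ, Fibre) φ x) (v : TangentSpace (𝓡 4) x) :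
    dAlong (fun y => rep (b y) *ᵥ φ y) x v =
      rep (b x) *ᵥ dAlong φ x v + rep (dForm b x v) *ᵥ φ x := by
  have h := dAlong_bilinear (repBilin.comp coord.symm.toLinearMap) (hb.mdifferentiableAt x) hφ v
  simp only [LinearMap.comp_apply, LinearEquiv.coe_coe, LinearEquiv.symm_apply_apply,
    repBilin_apply] at h
  exact h

theorem contMDiffOn_rep_mulVec {b : M → ASM × ASM} (hb : InAlg b) {φ : M → Fibre} {s : Set M}
    (hφ : ContMDiffOn (𝓡 4) 𝓘(ℝ, Fibre) ∞ φ s) :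
    ContMDiffOn (𝓡 4) 𝓘(ℝ, Fibre) ∞ (fun y => rep (b y) *ᵥ φ y) s := by
  refine (contMDiffOn_bilinear (repBilin.comp coord.symm.toLinearMap)
    (inAlg_iff.1 hb).contMDiffOn hφ).congr fun y _ => ?_
  simp [repBilin_apply]

theorem continuousOn_dForm [IsManifold (𝓡 4) ∞ M] {b : M → ASM × ASM} (hb : InAlg b)
    {X : (x : M) → TangentSpace (𝓡 4) x} {s : Set M}
    (hX : ContinuousOn (fun x => (⟨x, X x⟩ : TangentBundle (𝓡 4) M)) s) :
    ContinuousOn (fun x => dForm b x (X x)) s := by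
  have h : Continuous coord.symm.toLinearMap := LinearMap.continuous_of_finiteDimensional _
  exact h.comp_continuousOn (continuousOn_dAlong (inAlg_iff.1 hb) hX)

theorem InAlg.continuous {b : M → ASM × ASM} (hb : InAlg b) : Continuous b := by
  have h : Continuous coord.symm.toLinearMap := LinearMap.continuous_of_finiteDimensional _
  simpa [Function.comp_def] using h.comp (inAlg_iff.1 hb).continuous

end Differential

/-! ## The Dirac operator and free one-forms -/

section Operators

variable {M : Type*} [TopologicalSpace M] [ChartedSpace E4 M]

/-- The components of a one-form with values in the algebra. -/
noncomputable def OneForm.components (η : OneForm M) : Components M where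
  cr x := LinearMap.fst ℝ _ _ ∘ₗ LinearMap.fst ℝ _ _ ∘ₗ η x
  cl x := LinearMap.fst ℝ _ _ ∘ₗ LinearMap.snd ℝ _ _ ∘ₗ η x
  qr x := LinearMap.fst ℝ _ _ ∘ₗ LinearMap.snd ℝ _ _ ∘ₗ LinearMap.snd ℝ _ _ ∘ₗ η x
  ql x := LinearMap.fst ℝ _ _ ∘ₗ LinearMap.snd ℝ _ _ ∘ₗ LinearMap.fst ℝ _ _ ∘ₗ η x
  mr x := LinearMap.snd ℝ _ _ ∘ₗ LinearMap.snd ℝ _ _ ∘ₗ LinearMap.fst ℝ _ _ ∘ₗ η x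
  ml x := LinearMap.snd ℝ _ _ ∘ₗ LinearMap.snd ℝ _ _ ∘ₗ LinearMap.snd ℝ _ _ ∘ₗ η x

/-- The one-form with given components. -/
noncomputable def Components.form (w : Components M) : OneForm M := fun x =>
  ((w.cr x).prod ((w.ql x).prod (w.mr x))).prod ((w.cl x).prod ((w.qr x).prod (w.ml x)))

/-- The one-form `Σ_k ρ(a_k) d b_k`. -/
noncomputable def freeForm {n : ℕ} (a b : Fin n → M → ASM × ASM) : OneForm M :=
  ∑ k, fun x => LinearMap.mulLeft ℝ (a k x).swap ∘ₗ dForm (b k) x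

theorem freeForm_apply {n : ℕ} (a b : Fin n → M → ASM × ASM) (x : M) (v : TangentSpace (𝓡 4) x) :
    freeForm a b x v = ∑ k, (a k x).swap * dForm (b k) x v := by
  simp [freeForm, Finset.sum_apply, LinearMap.sum_apply]

/-- The gauge transform `u d(u*) + u η u*` of a one-form. -/
noncomputable def gaugeForm (u : M → ASM × ASM) (η : OneForm M) : OneForm M := fun x =>
  LinearMap.mulLeft ℝ (u x) ∘ₗ (dForm (star u) x + LinearMap.mulRight ℝ (star (u x)) ∘ₗ η x)

theorem gaugeForm_apply (u : M → ASM × ASM) (η : OneForm M) (x : M) (v : TangentSpace (𝓡 4) x) :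
    gaugeForm u η x v = u x * dForm (star u) x v + u x * η x v * star (u x) := by
  simp [gaugeForm, mul_add, mul_assoc]

variable [IsManifold (𝓡 4) ∞ M] {g : Metric4 M} (σ : SpinStructure g)

/-- The operator `-i γ^μ η_μ` of a one-form `η`. -/
noncomputable def formOp (η : OneForm M) : SectionOp M := fun ψ x =>
  (-Complex.I) • ∑ a, onSpin (gam a) *ᵥ (rep (η x (σ.e (σ.at' x) a x)) *ᵥ ψ x)

/-- The halves of `w.form` are (c^r, q^l, m^r) and (c^l, q^r, m^l). The quaternions are crossed
because the right block of `rep` takes its quaternion from the second half; thus `rep (w.form x v)`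
unfolds to `w.matrix x v`. -/
theorem hasComponents_iff {A : SectionOp M} {w : Components M} :
    HasComponents σ A w ↔ ∀ ψ, IsSmoothSection σ ψ → A ψ = formOp σ w.form ψ :=
  ⟨fun h ψ hψ => funext fun x => h ψ hψ x, fun h ψ hψ x => congrFun (h ψ hψ) x⟩

theorem hasComponents_components_iff {A : SectionOp M} {η : OneForm M} :
    HasComponents σ A η.components ↔ ∀ ψ, IsSmoothSection σ ψ → A ψ = formOp σ η ψ :=
  hasComponents_iff σ

variable {σ}

theorem SpinStructure.S_self {i : σ.ι} {x : M} (hx : x ∈ σ.U i) : σ.S i i x = 1 :=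
  mul_left_cancel (a := σ.S i i x)
    ((σ.cocycle i i i x ⟨⟨hx, hx⟩, hx⟩).trans (mul_one _).symm)

theorem localRep_at (ψ : M → Fibre) (x : M) : localRep σ ψ (σ.at' x) x = ψ x := by
  rw [localRep, SpinStructure.S_self (σ.mem_U x), spinMatrix_one, onSpin_one, Matrix.one_mulVec]

theorem localRep_act (b : M → ASM × ASM) (ψ : M → Fibre) (i : σ.ι) (y : M) :
    localRep σ (act b ψ) i y = rep (b y) *ᵥ localRep σ ψ i y := by
  simp only [localRep, act, Matrix.mulVec_mulVec, rep_mul_onSpin_spinMatrix]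

theorem IsSmoothSection.mdifferentiableAt {ψ : M → Fibre} (hψ : IsSmoothSection σ ψ) {i : σ.ι}
    {x : M} (hx : x ∈ σ.U i) :
    MDifferentiableAt (𝓡 4) 𝓘(ℝ, Fibre) (localRep σ ψ i) x :=
  ((hψ i).contMDiffAt ((σ.isOpen_U i).mem_nhds hx)).mdifferentiableAt (by simp)

theorem IsSmoothSection.act {ψ : M → Fibre} (hψ : IsSmoothSection σ ψ) {b : M → ASM × ASM}
    (hb : InAlg b) : IsSmoothSection σ (act b ψ) := fun i =>
  (contMDiffOn_rep_mulVec hb (hψ i)).congr fun y _ => localRep_act b ψ i y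

/-- The connection is quadratic in the Dirac matrices: passing an element through two of them twists
it twice, which changes nothing. -/
theorem onSpin_spinConn_mul_rep (e : Fin 4 → (x : M) → TangentSpace (𝓡 4) x) (x : M) (a : Fin 4)
    (b : ASM × ASM) : onSpin (spinConn g e x a) * rep b = rep b * onSpin (spinConn g e x a) := by
  simp only [spinConn, onSpin_smul, onSpin_sum, onSpin_mul, Matrix.smul_mul, Matrix.mul_smul,
    Finset.sum_mul, Finset.mul_sum]
  congr 1
  refine Finset.sum_congr rfl fun p _ => Finset.sum_congr rfl fun q _ => ?_
  rw [Matrix.mul_assoc, ← Prod.swap_swap b, ← rep_mul_onSpin_gam, ← Matrix.mul_assoc,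
    ← rep_mul_onSpin_gam, Matrix.mul_assoc, Prod.swap_swap]

/-- The twisted commutator is the operator of the differential. -/
theorem twistedComm_eq {b : M → ASM × ASM} (hb : InAlg b) {ψ : M → Fibre}
    (hψ : IsSmoothSection σ ψ) : twistedComm σ b ψ = formOp σ (dForm b) ψ := by
  funext x
  have h₁ : ∀ v, dAlong (localRep σ (act b ψ) (σ.at' x)) x v =
      rep (b x) *ᵥ dAlong (localRep σ ψ (σ.at' x)) x v + rep (dForm b x v) *ᵥ ψ x := by
    intro v
    have h := dAlong_rep_mulVec hb (hψ.mdifferentiableAt (σ.mem_U x)) v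
    rw [localRep_at] at h
    rw [← h]
    congr 1
    exact funext fun y => localRep_act b ψ _ y
  have h₂ : ∀ (c : ASM × ASM) (a : Fin 4) (χ : Fibre),
      rep c.swap *ᵥ (onSpin (gam a) *ᵥ χ) = onSpin (gam a) *ᵥ (rep c *ᵥ χ) := by
    intro c a χ
    rw [Matrix.mulVec_mulVec, rep_mul_onSpin_gam, Prod.swap_swap, Matrix.mulVec_mulVec]
  have h₃ : ∀ a, onSpin (spinConn g (σ.e (σ.at' x)) x a) *ᵥ (rep (b x) *ᵥ ψ x) =
      rep (b x) *ᵥ (onSpin (spinConn g (σ.e (σ.at' x)) x a) *ᵥ ψ x) := by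
    intro a
    rw [Matrix.mulVec_mulVec, onSpin_spinConn_mul_rep, Matrix.mulVec_mulVec]
  have h₄ : act (twist b) (dirac σ ψ) x = (-Complex.I) • ∑ a, onSpin (gam a) *ᵥ
      (rep (b x) *ᵥ dAlong (localRep σ ψ (σ.at' x)) x (σ.e (σ.at' x) a x) +
        rep (b x) *ᵥ (onSpin (spinConn g (σ.e (σ.at' x)) x a) *ᵥ ψ x)) := by
    simp only [act, twist, dirac, Matrix.mulVec_smul, Matrix.mulVec_sum, h₂, Matrix.mulVec_add]
  have h₅ : dirac σ (act b ψ) x = (-Complex.I) • ∑ a, onSpin (gam a) *ᵥ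
      ((rep (b x) *ᵥ dAlong (localRep σ ψ (σ.at' x)) x (σ.e (σ.at' x) a x) +
        rep (dForm b x (σ.e (σ.at' x) a x)) *ᵥ ψ x) +
        rep (b x) *ᵥ (onSpin (spinConn g (σ.e (σ.at' x)) x a) *ᵥ ψ x)) := by
    simp only [dirac, h₁]
    simp only [act, h₃]
  -- Since ρ(b) γ^a = γ^a b, the terms with the derivative of ψ and with the connection occur in
  -- both summands and cancel; the term with db from the Leibniz rule remains.
  rw [twistedComm, Pi.sub_apply, h₄, h₅, formOp, ← smul_sub, ← Finset.sum_sub_distrib]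
  congr 1
  refine Finset.sum_congr rfl fun a _ => ?_
  rw [← Matrix.mulVec_sub]
  congr 1
  abel

/-- A factor on the left has to pass γ^a to reach η and is twisted on the way, whereas a factor on
the right stands next to η. Hence ρ(a_k) appears in `freeForm`. -/
theorem act_formOp (a : M → ASM × ASM) (η : OneForm M) (ψ : M → Fibre) :
    act a (formOp σ η ψ) = formOp σ (fun x => LinearMap.mulLeft ℝ (a x).swap ∘ₗ η x) ψ := by
  funext x
  simp only [act, formOp, Matrix.mulVec_smul, Matrix.mulVec_sum, LinearMap.comp_apply,
    LinearMap.mulLeft_apply, rep_mul, Matrix.mulVec_mulVec]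
  congr 1
  refine Finset.sum_congr rfl fun b _ => ?_
  rw [← Matrix.mul_assoc, rep_mul_onSpin_gam, Matrix.mul_assoc]

theorem formOp_act (b : M → ASM × ASM) (η : OneForm M) (ψ : M → Fibre) :
    formOp σ η (act b ψ) = formOp σ (fun x => LinearMap.mulRight ℝ (b x) ∘ₗ η x) ψ := by
  funext x
  simp only [act, formOp, LinearMap.comp_apply, LinearMap.mulRight_apply, rep_mul,
    Matrix.mulVec_mulVec]

theorem formOp_add (η θ : OneForm M) (ψ : M → Fibre) :
    formOp σ (η + θ) ψ = formOp σ η ψ + formOp σ θ ψ := by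
  funext x
  simp only [formOp, Pi.add_apply, LinearMap.add_apply, rep_add, Matrix.add_mulVec,
    Matrix.mulVec_add, Finset.sum_add_distrib, smul_add]

theorem formOp_zero (ψ : M → Fibre) : formOp σ (0 : OneForm M) ψ = 0 := by
  funext x
  simp [formOp, rep_zero]

theorem formOp_sum {κ : Type*} (s : Finset κ) (η : κ → OneForm M) (ψ : M → Fibre) :
    formOp σ (∑ k ∈ s, η k) ψ = ∑ k ∈ s, formOp σ (η k) ψ := by
  classical
  induction s using Finset.induction_on with
  | empty => simp [formOp_zero]
  | insert a s ha ih => rw [Finset.sum_insert ha, Finset.sum_insert ha, formOp_add, ih]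

theorem sum_act_twistedComm {n : ℕ} (a : Fin n → M → ASM × ASM) {b : Fin n → M → ASM × ASM}
    (hb : ∀ k, InAlg (b k)) {ψ : M → Fibre} (hψ : IsSmoothSection σ ψ) :
    ∑ k, act (a k) (twistedComm σ (b k) ψ) = formOp σ (freeForm a b) ψ := by
  rw [freeForm, formOp_sum]
  exact Finset.sum_congr rfl fun k _ => by rw [twistedComm_eq (hb k) hψ, act_formOp]

/-- A one-form is continuous if its components in the frames of the spin structure are. -/
def IsContinuousForm (σ : SpinStructure g) (η : OneForm M) : Prop :=
  ∀ i a, ContinuousOn (fun x => η x (σ.e i a x)) (σ.U i)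

theorem continuous_swap_mul {X : Type*} [TopologicalSpace X] {s : Set X} {a b : X → ASM × ASM}
    (ha : ContinuousOn a s) (hb : ContinuousOn b s) : ContinuousOn (fun x => (a x).swap * b x) s :=
  (continuous_swap.comp_continuousOn ha).mul hb

theorem isContinuousForm_dForm {b : M → ASM × ASM} (hb : InAlg b) :
    IsContinuousForm σ (dForm b) := fun i a =>
  continuousOn_dForm hb (σ.smooth_e i a).continuousOn

/-- Continuity along the frames is all that the integral argument for selfadjointness requires. -/
theorem isContinuousForm_freeForm {n : ℕ} {a b : Fin n → M → ASM × ASM} (ha : ∀ k, InAlg (a k))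
    (hb : ∀ k, InAlg (b k)) : IsContinuousForm σ (freeForm a b) := fun i c => by
  simp only [freeForm_apply]
  exact continuousOn_finsetSum _ fun k _ =>
    continuous_swap_mul (ha k).continuous.continuousOn (isContinuousForm_dForm (hb k) i c)

/-- A free one-form is the operator of a continuous form. -/
theorem IsFreeOneForm.exists_form {A : SectionOp M} (hA : IsFreeOneForm σ A) :
    ∃ η : OneForm M, IsContinuousForm σ η ∧ ∀ ψ, IsSmoothSection σ ψ → A ψ = formOp σ η ψ := by
  obtain ⟨n, a, b, ha, hb, h⟩ := hA
  exact ⟨freeForm a b, isContinuousForm_freeForm ha hb, fun ψ hψ =>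
    (h ψ hψ).trans (sum_act_twistedComm a hb hψ)⟩

/-- The factor ρ(u) of the action is twisted back to u when it passes γ^μ, which leaves the
untwisted formula for η. -/
theorem gaugeAct_eq {u : M → ASM × ASM} (hu : InAlg u) {A : SectionOp M} {η : OneForm M}
    (hA : ∀ ψ, IsSmoothSection σ ψ → A ψ = formOp σ η ψ) {ψ : M → Fibre}
    (hψ : IsSmoothSection σ ψ) : gaugeAct σ u A ψ = formOp σ (gaugeForm u η) ψ := by
  rw [gaugeAct, hA _ (hψ.act hu.star), formOp_act, twistedComm_eq hu.star hψ, ← formOp_add,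
    act_formOp]
  rfl

theorem isContinuousForm_gaugeForm {u : M → ASM × ASM} (hu : InAlg u) {η : OneForm M}
    (hη : IsContinuousForm σ η) : IsContinuousForm σ (gaugeForm u η) := fun i a => by
  simp only [gaugeForm_apply]
  have hu' := hu.continuous.continuousOn (s := σ.U i)
  exact (hu'.mul (isContinuousForm_dForm hu.star i a)).add
    ((hu'.mul (hη i a)).mul (hu.star.continuous.continuousOn))

end Operators

/-! ## The Riemannian volume -/

section VolumeMeasure

variable {M : Type*} [TopologicalSpace M] [ChartedSpace E4 M] [IsManifold (𝓡 4) ∞ M]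

theorem mfderiv_extChartAt_symm_injective {x₀ : M} {y : E4}
    (hy : y ∈ (extChartAt (𝓡 4) x₀).target) :
    Function.Injective (mfderiv 𝓘(ℝ, E4) (𝓡 4) (extChartAt (𝓡 4) x₀).symm y) := by
  have h := isInvertible_mfderivWithin_extChartAt_symm (I := 𝓡 4) hy
  rw [ModelWithCorners.Boundaryless.range_eq_univ, mfderivWithin_univ] at h
  exact h.injective

theorem continuousOn_coordVec (x₀ : M) (i : Fin 4) :
    ContinuousOn (fun y => (⟨(extChartAt (𝓡 4) x₀).symm y, coordVec x₀ y i⟩ :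
      TangentBundle (𝓡 4) M)) (extChartAt (𝓡 4) x₀).target := by
  have ht : IsOpen (extChartAt (𝓡 4) x₀).target := isOpen_extChartAt_target x₀
  have h₁ := (contMDiffOn_extChartAt_symm (n := ∞) (I := 𝓡 4) x₀).continuousOn_tangentMapWithin
    (by simp) ht.uniqueMDiffOn
  have h₂ : Continuous (fun y : E4 => ((tangentBundleModelSpaceHomeomorph 𝓘(ℝ, E4)).symm
      (y, (EuclideanSpace.single i (1 : ℝ) : E4)) : TangentBundle 𝓘(ℝ, E4) E4)) :=
    (tangentBundleModelSpaceHomeomorph 𝓘(ℝ, E4)).symm.continuous.comp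
      (continuous_id.prodMk continuous_const)
  refine (h₁.comp h₂.continuousOn fun y hy => hy).congr fun y hy => ?_
  simp only [Function.comp_apply, tangentMapWithin, coordVec]
  rw [← mfderivWithin_of_mem_nhds (ht.mem_nhds hy)]
  rfl

theorem continuousOn_inner (g : Metric4 M) {X : Type*} [TopologicalSpace X] {s : Set X}
    {b : X → M} {v w : (y : X) → TangentSpace (𝓡 4) (b y)}
    (hv : ContinuousOn (fun y => (⟨b y, v y⟩ : TangentBundle (𝓡 4) M)) s)
    (hw : ContinuousOn (fun y => (⟨b y, w y⟩ : TangentBundle (𝓡 4) M)) s) :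
    ContinuousOn (fun y => g.inner (b y) (v y) (w y)) s := by
  intro y hy
  have hb : ContinuousWithinAt b s y :=
    (FiberBundle.continuous_proj E4 (TangentSpace (𝓡 4))).continuousAt.comp_continuousWithinAt
      (hv y hy)
  have h : ContinuousWithinAt
      (fun m ↦ Bundle.TotalSpace.mk' ℝ (E := Bundle.Trivial M ℝ) (b m)
        (g.inner (b m) (v m) (w m))) s y :=
    (g.contMDiff.continuous.continuousAt.comp_continuousWithinAt hb).clm_bundle_apply₂
      (F₁ := E4) (F₂ := E4) (hv y hy) (hw y hy)
  simp only [FiberBundle.continuousWithinAt_totalSpace] at h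
  exact h.2

theorem continuousOn_volDensity (g : Metric4 M) (x₀ : M) :
    ContinuousOn (volDensity g x₀) (extChartAt (𝓡 4) x₀).target := by
  refine Real.continuous_sqrt.comp_continuousOn ?_
  have : ContinuousOn (fun y => Matrix.of fun i j : Fin 4 =>
      g.inner ((extChartAt (𝓡 4) x₀).symm y) (coordVec x₀ y i) (coordVec x₀ y j))
      (extChartAt (𝓡 4) x₀).target := by
    refine continuousOn_pi.2 fun i => continuousOn_pi.2 fun j => ?_
    exact continuousOn_inner g (continuousOn_coordVec x₀ i) (continuousOn_coordVec x₀ j)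
  exact (Continuous.matrix_det continuous_id).comp_continuousOn this

theorem volDensity_pos (g : Metric4 M) {x₀ : M} {y : E4}
    (hy : y ∈ (extChartAt (𝓡 4) x₀).target) : 0 < volDensity g x₀ y := by
  refine Real.sqrt_pos.2 (Matrix.PosDef.det_pos (Matrix.posDef_iff_dotProduct_mulVec.2 ⟨?_, ?_⟩))
  · refine Matrix.IsHermitian.ext fun i j => ?_
    simp only [Matrix.of_apply, star_trivial]
    exact g.symm _ _ _
  · intro c hc
    set p := (extChartAt (𝓡 4) x₀).symm y
    -- The quadratic form of the Gram matrix at `c` is the squared length of Σ c_i ∂_i. This vector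
    -- is the image of `c` under the injective derivative of the inverse chart.
    have h : star c ⬝ᵥ ((Matrix.of fun i j : Fin 4 =>
        g.inner p (coordVec x₀ y i) (coordVec x₀ y j)) *ᵥ c) =
        g.inner p (∑ i, c i • coordVec x₀ y i) (∑ i, c i • coordVec x₀ y i) := by
      simp only [map_sum, map_smul, dotProduct, Matrix.mulVec, Matrix.of_apply,
        sum_apply, smul_apply, smul_eq_mul,
        Finset.mul_sum, star_trivial]
      rw [Finset.sum_comm]
      exact Finset.sum_congr rfl fun i _ => Finset.sum_congr rfl fun j _ => by ring
    rw [h]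
    refine g.pos _ _ fun h0 => hc ?_
    let T : E4 →L[ℝ] TangentSpace (𝓡 4) p := mfderiv 𝓘(ℝ, E4) (𝓡 4) (extChartAt (𝓡 4) x₀).symm y
    have h₁ : ∑ i, c i • coordVec x₀ y i = T (∑ i, c i • EuclideanSpace.single i (1 : ℝ)) := by
      rw [map_sum]
      exact Finset.sum_congr rfl fun i _ => (map_smul T _ _).symm
    rw [h₁] at h0
    have h₂ : ∑ i, c i • EuclideanSpace.single i (1 : ℝ) = (0 : E4) :=
      mfderiv_extChartAt_symm_injective hy (h0.trans (map_zero T).symm)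
    funext i
    have h₃ := congrArg (fun z : E4 => z i) h₂
    simpa [Pi.single_apply] using h₃

/-- The measure in the coordinates of a chart of which `chartVolume` is the image. -/
noncomputable def coordVolume (g : Metric4 M) (x₀ : M) : Measure E4 :=
  ((volume : Measure E4).restrict (extChartAt (𝓡 4) x₀).target).withDensity
    (fun y => ENNReal.ofReal (volDensity g x₀ y))

theorem aemeasurable_volDensity (g : Metric4 M) (x₀ : M) :
    AEMeasurable (fun y => ENNReal.ofReal (volDensity g x₀ y))
      ((volume : Measure E4).restrict (extChartAt (𝓡 4) x₀).target) :=
  ((continuousOn_volDensity g x₀).aemeasurable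
    (isOpen_extChartAt_target x₀).measurableSet).ennreal_ofReal

variable [MeasurableSpace M] [BorelSpace M]

/-- The inverse chart is controlled only on its target. Almost everywhere measurability for the
restricted measure suffices, and it must be checked because `Measure.map` has the default value 0
without it. -/
theorem chartVolume_apply (g : Metric4 M) (x₀ : M) {s : Set M} (hs : MeasurableSet s) :
    chartVolume g x₀ s = coordVolume g x₀ ((extChartAt (𝓡 4) x₀).symm ⁻¹' s) := by
  refine Measure.map_apply_of_aemeasurable ?_ hs
  have h : AEMeasurable (extChartAt (𝓡 4) x₀).symm
      ((volume : Measure E4).restrict (extChartAt (𝓡 4) x₀).target) :=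
    (continuousOn_extChartAt_symm x₀).aemeasurable (isOpen_extChartAt_target x₀).measurableSet
  exact h.mono_ac (withDensity_absolutelyContinuous _ _)

/-- In coordinates the set contains a nonempty open subset of the target, on which the density is
positive. -/
theorem chartVolume_ne_zero (g : Metric4 M) {x₀ : M} {s : Set M} (hs : IsOpen s)
    (h : (s ∩ (chartAt E4 x₀).source).Nonempty) : chartVolume g x₀ s ≠ 0 := by
  rw [chartVolume_apply g x₀ hs.measurableSet, coordVolume, Ne,
    withDensity_apply_eq_zero' (aemeasurable_volDensity g x₀)]
  intro h0
  set φ := extChartAt (𝓡 4) x₀ with hφ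
  have ho : IsOpen (φ.target ∩ φ.symm ⁻¹' s) :=
    (continuousOn_extChartAt_symm x₀).isOpen_inter_preimage (isOpen_extChartAt_target x₀) hs
  obtain ⟨x, hxs, hx⟩ := h
  rw [← extChartAt_source (𝓡 4)] at hx
  have hne : (φ.target ∩ φ.symm ⁻¹' s).Nonempty :=
    ⟨φ x, φ.map_source hx, by rwa [Set.mem_preimage, φ.left_inv hx]⟩
  refine ho.measure_ne_zero (volume : Measure E4) hne ?_
  have h₁ : volume.restrict φ.target (φ.target ∩ φ.symm ⁻¹' s) = 0 := by
    refine measure_mono_null ?_ h0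
    intro y hy
    refine ⟨?_, hy.2⟩
    simpa using volDensity_pos g hy.1
  rwa [Measure.restrict_apply ho.measurableSet,
    Set.inter_eq_left.2 Set.inter_subset_left] at h₁

/-- In coordinates the set is compact and the density is continuous on it. -/
theorem chartVolume_lt_top [T2Space M] (g : Metric4 M) {x₀ : M} {K : Set M} (hK : IsCompact K)
    (h : K ⊆ (chartAt E4 x₀).source) : chartVolume g x₀ K < ⊤ := by
  set φ := extChartAt (𝓡 4) x₀ with hφ
  have hs : K ⊆ φ.source := by rwa [hφ, extChartAt_source]
  have hc : IsCompact (φ '' K) := hK.image_of_continuousOn ((continuousOn_extChartAt x₀).mono hs)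
  have hct : φ '' K ⊆ φ.target := by
    rintro _ ⟨x, hx, rfl⟩
    exact φ.map_source (hs hx)
  have hsub : φ.target ∩ φ.symm ⁻¹' K ⊆ φ '' K := fun y hy => ⟨φ.symm y, hy.2, φ.right_inv hy.1⟩
  rw [chartVolume_apply g x₀ hK.measurableSet, coordVolume, withDensity_apply',
    Measure.restrict_restrict' (isOpen_extChartAt_target x₀).measurableSet]
  calc _ ≤ ∫⁻ y in φ '' K, ENNReal.ofReal (volDensity g x₀ y) :=
          lintegral_mono_set fun y hy => hsub ⟨hy.2, hy.1⟩
      _ < ⊤ := by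
          have hi : IntegrableOn (volDensity g x₀) (φ '' K) :=
            ((continuousOn_volDensity g x₀).mono hct).integrableOn_compact hc
          exact (lintegral_ofReal_le_lintegral_enorm _).trans_lt hi.hasFiniteIntegral

variable [CompactSpace M] [T2Space M]

/-- At any point of an open set some function of the partition is positive, and the corresponding
summand already charges the set. This is what lets integrals detect a failure of symmetry at a
single point. -/
instance isOpenPosMeasure_riemannianVolume (g : Metric4 M) :
    (riemannianVolume g).IsOpenPosMeasure := by
  refine ⟨fun O hO ⟨x, hx⟩ h0 => ?_⟩
  have hf := (exists_partition M).choose_spec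
  set f := (exists_partition M).choose with hfdef
  obtain ⟨x₀, hx₀⟩ : ∃ x₀, 0 < f x₀ x := f.exists_pos_of_mem (Set.mem_univ x)
  have h₁ : (chartVolume g x₀).withDensity (fun x => ENNReal.ofReal (f x₀ x)) O = 0 :=
    le_antisymm ((Measure.le_sum (fun x₀ : M => (chartVolume g x₀).withDensity
      (fun x => ENNReal.ofReal (f x₀ x))) x₀ O).trans h0.le) zero_le
  rw [withDensity_apply_eq_zero (f x₀).contMDiff.continuous.measurable.ennreal_ofReal] at h₁
  have h₂ : IsOpen ({x | ENNReal.ofReal (f x₀ x) ≠ 0} ∩ O) :=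
    IsOpen.inter (isOpen_ne_fun (ENNReal.continuous_ofReal.comp (f x₀).contMDiff.continuous)
      continuous_const) hO
  refine chartVolume_ne_zero g h₂ ⟨x, ⟨?_, hx⟩, ?_⟩ h₁
  · simpa using hx₀
  · exact hf x₀ (subset_tsupport _ hx₀.ne')

/-- By compactness only finitely many functions of the partition are nonzero, each supported in a
compact part of its chart. Continuous integrands are therefore integrable, and their integrals do
not take the default value 0. -/
instance isFiniteMeasure_riemannianVolume (g : Metric4 M) :
    IsFiniteMeasure (riemannianVolume g) := by
  refine ⟨?_⟩
  have hf := (exists_partition M).choose_spec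
  rw [riemannianVolume, Measure.sum_apply _ MeasurableSet.univ]
  set f := (exists_partition M).choose with hfdef
  have hfin : {x₀ | (Function.support (f x₀)).Nonempty}.Finite :=
    f.locallyFinite.finite_nonempty_of_compact
  rw [tsum_eq_sum (s := hfin.toFinset)]
  · refine ENNReal.sum_lt_top.2 fun x₀ _ => ?_
    have hK : IsCompact (tsupport (f x₀)) := (isClosed_tsupport _).isCompact
    rw [withDensity_apply _ MeasurableSet.univ, Measure.restrict_univ]
    calc ∫⁻ x, ENNReal.ofReal (f x₀ x) ∂chartVolume g x₀
        ≤ ∫⁻ x, (tsupport (f x₀)).indicator 1 x ∂chartVolume g x₀ := by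
          refine lintegral_mono fun x => ?_
          by_cases hx : x ∈ tsupport (f x₀)
          · simpa [hx] using f.le_one x₀ x
          · simp [hx, image_eq_zero_of_notMem_tsupport hx]
      _ = chartVolume g x₀ (tsupport (f x₀)) := lintegral_indicator_one hK.measurableSet
      _ < ⊤ := chartVolume_lt_top g hK (hf x₀)
  · intro x₀ hx₀
    have h0 : ∀ x, f x₀ x = 0 := by
      simpa [Set.Nonempty, Function.mem_support] using hx₀
    rw [withDensity_apply _ MeasurableSet.univ]
    simp [h0]

end VolumeMeasure

/-! ## Sections with given values, and selfadjointness -/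

section LocalSections

variable {M : Type*} [TopologicalSpace M] [ChartedSpace E4 M] [IsManifold (𝓡 4) ∞ M]
  {g : Metric4 M} {σ : SpinStructure g}

/-- The matrix of the operator of a one-form in the frame `i`. -/
noncomputable def formMatrix (σ : SpinStructure g) (η : OneForm M) (i : σ.ι) (x : M) :
    Matrix Idx Idx ℂ :=
  (-Complex.I) • ∑ a, onSpin (gam a) * rep (η x (σ.e i a x))

theorem formOp_apply (η : OneForm M) (ψ : M → Fibre) (x : M) :
    formOp σ η ψ x = formMatrix σ η (σ.at' x) x *ᵥ ψ x := by
  simp only [formOp, formMatrix, Matrix.smul_mulVec, Matrix.sum_mulVec, Matrix.mulVec_mulVec]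

/-- Expansion of a tangent vector in an orthonormal frame. -/
theorem SpinStructure.sum_inner_smul {i : σ.ι} {x : M} (hx : x ∈ σ.U i)
    (v : TangentSpace (𝓡 4) x) : ∑ b, g.inner x v (σ.e i b x) • σ.e i b x = v := by
  have hinner : ∀ (c : Fin 4 → ℝ) a, g.inner x (∑ b, c b • σ.e i b x) (σ.e i a x) = c a := by
    intro c a
    simp [map_sum, sum_apply, σ.orthonormal i x hx]
  have hli : LinearIndependent ℝ (fun a => σ.e i a x) := by
    refine Fintype.linearIndependent_iff.2 fun c hc a => ?_
    rw [← hinner c a, hc, map_zero]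
    rfl
  have hcard : Fintype.card (Fin 4) = Module.finrank ℝ (TangentSpace (𝓡 4) x) := by
    rw [show Module.finrank ℝ (TangentSpace (𝓡 4) x) = Module.finrank ℝ E4 from rfl]
    simp
  have : FiniteDimensional ℝ (TangentSpace (𝓡 4) x) := inferInstanceAs (FiniteDimensional ℝ E4)
  have hspan := hli.span_eq_top_of_card_eq_finrank' hcard
  have hv : v ∈ Submodule.span ℝ (Set.range fun a => σ.e i a x) := hspan ▸ Submodule.mem_top
  obtain ⟨c, rfl⟩ := (Submodule.mem_span_range_iff_exists_fun ℝ).1 hv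
  simp only [hinner]

/-- One-forms that agree on a frame agree. -/
theorem SpinStructure.form_ext {i : σ.ι} {x : M} (hx : x ∈ σ.U i)
    {L L' : TangentSpace (𝓡 4) x →ₗ[ℝ] ASM × ASM}
    (h : ∀ a, L (σ.e i a x) = L' (σ.e i a x)) : L = L' := by
  ext1 v
  rw [← SpinStructure.sum_inner_smul hx v, map_sum, map_sum]
  simp only [map_smul, h]

theorem cliffordMatrix_frame {i : σ.ι} {x : M} (hx : x ∈ σ.U i) (b : Fin 4) :
    cliffordMatrix g (σ.e i) x (σ.e i b x) = gam b := by
  simp [cliffordMatrix, σ.orthonormal i x hx]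

/-- The operator of a one-form does not depend on the frame. -/
theorem localRep_formOp (η : OneForm M) (ψ : M → Fibre) {i : σ.ι} {x : M} (hx : x ∈ σ.U i) :
    localRep σ (formOp σ η ψ) i x = formMatrix σ η i x *ᵥ localRep σ ψ i x := by
  set j := σ.at' x with hj
  have hxj : x ∈ σ.U j := σ.mem_U x
  -- The covering condition at e_b of frame `j`. The spin matrix rotates the γ's by the same
  -- orthogonal matrix that relates the two frames in `h₂`, so in `h₃` both sides are one double sum
  -- in two orders.
  have h₁ : ∀ b, spinMatrix (σ.S i j x) * gam b =
      ∑ a, ((g.inner x (σ.e j b x) (σ.e i a x) : ℝ) : ℂ) • (gam a * spinMatrix (σ.S i j x)) := by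
    intro b
    rw [← cliffordMatrix_frame hxj b, σ.covers i j x ⟨hx, hxj⟩, cliffordMatrix, Finset.sum_mul]
    simp only [Matrix.smul_mul]
  have h₂ : ∀ a, η x (σ.e i a x) =
      ∑ b, g.inner x (σ.e j b x) (σ.e i a x) • η x (σ.e j b x) := by
    intro a
    conv_lhs => rw [← SpinStructure.sum_inner_smul hxj (σ.e i a x), map_sum]
    simp only [map_smul, g.symm x (σ.e i a x)]
  have h₃ : onSpin (spinMatrix (σ.S i j x)) * formMatrix σ η j x =
      formMatrix σ η i x * onSpin (spinMatrix (σ.S i j x)) := by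
    rw [formMatrix, formMatrix, Matrix.mul_smul, Matrix.smul_mul, Finset.mul_sum, Finset.sum_mul]
    congr 1
    have e₁ : ∀ b, onSpin (spinMatrix (σ.S i j x)) * (onSpin (gam b) * rep (η x (σ.e j b x))) =
        ∑ a, g.inner x (σ.e j b x) (σ.e i a x) •
          (onSpin (gam a) * rep (η x (σ.e j b x)) * onSpin (spinMatrix (σ.S i j x))) := by
      intro b
      rw [← Matrix.mul_assoc, ← onSpin_mul, h₁, onSpin_sum, Finset.sum_mul]
      refine Finset.sum_congr rfl fun a _ => ?_
      rw [onSpin_smul, onSpin_mul, Matrix.smul_mul, Matrix.mul_assoc, Matrix.mul_assoc,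
        rep_mul_onSpin_spinMatrix, Complex.coe_smul]
    have e₂ : ∀ a, onSpin (gam a) * rep (η x (σ.e i a x)) * onSpin (spinMatrix (σ.S i j x)) =
        ∑ b, g.inner x (σ.e j b x) (σ.e i a x) •
          (onSpin (gam a) * rep (η x (σ.e j b x)) * onSpin (spinMatrix (σ.S i j x))) := by
      intro a
      rw [h₂, rep_sum, Finset.mul_sum, Finset.sum_mul]
      refine Finset.sum_congr rfl fun b _ => ?_
      rw [rep_smul, Matrix.mul_smul, Matrix.smul_mul]
    simp only [e₁, e₂]
    exact Finset.sum_comm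
  rw [localRep, formOp_apply, Matrix.mulVec_mulVec, ← hj, h₃, localRep, Matrix.mulVec_mulVec]

/-- The section supported in `U i` with components `f p` in the frame `i`. -/
noncomputable def localSection (σ : SpinStructure g) (i : σ.ι) (f : M → ℝ) (p : Fibre) :
    M → Fibre := fun y => f y • (onSpin (spinMatrix (σ.S (σ.at' y) i y)) *ᵥ p)

theorem localRep_localSection (i j : σ.ι) (f : M → ℝ) (p : Fibre) {y : M} (hi : y ∈ σ.U i)
    (hj : y ∈ σ.U j) : localRep σ (localSection σ i f p) j y =
      f y • (onSpin (spinMatrix (σ.S j i y)) *ᵥ p) := by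
  rw [localRep, localSection, Matrix.mulVec_smul, Matrix.mulVec_mulVec, ← onSpin_mul,
    ← spinMatrix_mul, σ.cocycle _ _ _ y ⟨⟨hj, σ.mem_U y⟩, hi⟩]

theorem localRep_localSection_self (i : σ.ι) (f : M → ℝ) (p : Fibre) {y : M} (hi : y ∈ σ.U i) :
    localRep σ (localSection σ i f p) i y = f y • p := by
  rw [localRep_localSection i i f p hi hi, SpinStructure.S_self hi, spinMatrix_one, onSpin_one,
    Matrix.one_mulVec]

/-- The action of spin matrices on a fixed vector of the fibre. -/
noncomputable def spinMulVec (p : Fibre) : (SpinIdx → SpinIdx → ℂ) →ₗ[ℝ] Fibre where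
  toFun A := onSpin (Matrix.of A) *ᵥ p
  map_add' A B := by
    rw [← Matrix.of_add_of, onSpin_add, Matrix.add_mulVec]
  map_smul' r A := by
    have : onSpin (Matrix.of (r • A)) = r • onSpin (Matrix.of A) := by
      simp only [onSpin, ← Matrix.smul_of, Matrix.smul_kronecker]
    rw [this, Matrix.smul_mulVec, RingHom.id_apply]

/-- On `U i` the transition functions are smooth; at other points `f` vanishes in a neighbourhood,
since its closed support lies in `U i`. -/
theorem isSmoothSection_localSection (i : σ.ι) {f : M → ℝ} (hf : ContMDiff (𝓡 4) 𝓘(ℝ, ℝ) ∞ f)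
    (hs : tsupport f ⊆ σ.U i) (p : Fibre) : IsSmoothSection σ (localSection σ i f p) := by
  intro j y hy
  by_cases hi : y ∈ σ.U i
  · have h₁ : ContMDiffOn (𝓡 4) 𝓘(ℝ, SpinIdx → SpinIdx → ℂ) ∞
        (fun x a b => spinMatrix (σ.S j i x) a b) (σ.U j ∩ σ.U i) :=
      contMDiffOn_pi_space.2 fun a => contMDiffOn_pi_space.2 fun b => σ.smooth_S j i a b
    have h₂ : ContMDiffOn (𝓡 4) 𝓘(ℝ, Fibre) ∞
        (fun x => f x • (onSpin (spinMatrix (σ.S j i x)) *ᵥ p)) (σ.U j ∩ σ.U i) :=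
      hf.contMDiffOn.smul
        ((spinMulVec p).toContinuousLinearMap.contDiff.contMDiff.comp_contMDiffOn h₁)
    have ho := ((σ.isOpen_U j).inter (σ.isOpen_U i)).mem_nhds ⟨hy, hi⟩
    refine ((h₂.contMDiffAt ho).congr_of_eventuallyEq ?_).contMDiffWithinAt
    filter_upwards [ho] with x hx
    exact localRep_localSection i j f p hx.2 hx.1
  · have h₁ : f =ᶠ[nhds y] 0 := notMem_tsupport_iff_eventuallyEq.1 fun h => hi (hs h)
    refine (contMDiffAt_const (c := (0 : Fibre))).contMDiffWithinAt.congr_of_eventuallyEq_of_mem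
      (Filter.Eventually.filter_mono nhdsWithin_le_nhds ?_) hy
    filter_upwards [h₁] with x hx
    simp [localRep, localSection, hx]

/-- Prescribed values at a point allow the matrix of an operator to be recovered from its action on
smooth sections. -/
theorem exists_smoothSection [T2Space M] (x : M) (p : Fibre) :
    ∃ ψ, IsSmoothSection σ ψ ∧ ψ x = p := by
  obtain ⟨f, hf, -⟩ := (SmoothBumpFunction.nhds_basis_support (I := 𝓡 4)
    ((σ.isOpen_U (σ.at' x)).mem_nhds (σ.mem_U x))).mem_iff.1
    ((σ.isOpen_U (σ.at' x)).mem_nhds (σ.mem_U x))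
  refine ⟨_, isSmoothSection_localSection (σ.at' x) f.contMDiff hf p, ?_⟩
  rw [← localRep_at (σ := σ) (localSection σ _ _ _), localRep_localSection_self _ _ _ (σ.mem_U x), f.eq_one, one_smul]

theorem eq_of_formMatrix_eq {η θ : OneForm M} {i : σ.ι} {x : M} (hx : x ∈ σ.U i)
    (h : formMatrix σ η i x = formMatrix σ θ i x) : η x = θ x := by
  refine SpinStructure.form_ext hx fun a => sub_eq_zero.1 ?_
  refine eq_zero_of_sum_gam_mul_rep (fun a => η x (σ.e i a x) - θ x (σ.e i a x)) ?_ a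
  simp only [rep_sub, Matrix.mul_sub, Finset.sum_sub_distrib]
  have hI : (-Complex.I) ≠ 0 := neg_ne_zero.2 Complex.I_ne_zero
  exact sub_eq_zero.2 (smul_right_injective _ hI h)

/-- A one-form is determined by its operator. -/
theorem form_eq_of_formOp_eq [T2Space M] {η θ : OneForm M}
    (h : ∀ ψ, IsSmoothSection σ ψ → formOp σ η ψ = formOp σ θ ψ) : η = θ := by
  funext x
  refine eq_of_formMatrix_eq (σ.mem_U x) (Matrix.mulVec_injective (funext fun p => ?_))
  obtain ⟨ψ, hψ, rfl⟩ := exists_smoothSection (σ := σ) x p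
  rw [← formOp_apply, ← formOp_apply, h ψ hψ]

/-- Changes of frame are unitary, so the integrand of `innerL2` may be computed in any frame. -/
theorem star_dotProduct_eq (ψ χ : M → Fibre) (i : σ.ι) (y : M) :
    star (ψ y) ⬝ᵥ χ y = star (localRep σ ψ i y) ⬝ᵥ localRep σ χ i y := by
  rw [localRep, localRep, Matrix.star_mulVec, ← Matrix.dotProduct_mulVec, Matrix.mulVec_mulVec,
    ← onSpin_conjTranspose, ← onSpin_mul, spinMatrix_star_mul, onSpin_one, Matrix.one_mulVec]

/-- The Dirac matrices are hermitian, and η* is twisted when it is moved back to the right of γ^a.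
-/
theorem conjTranspose_formMatrix (η : OneForm M) (i : σ.ι) (x : M) :
    (formMatrix σ η i x)ᴴ =
      Complex.I • ∑ a, onSpin (gam a) * rep (star (η x (σ.e i a x))).swap := by
  simp only [formMatrix, Matrix.conjTranspose_smul, Matrix.conjTranspose_sum,
    Matrix.conjTranspose_mul, ← onSpin_conjTranspose, gam_conjTranspose, ← rep_star,
    rep_mul_onSpin_gam]
  simp

/-- A one-form whose operator is symmetric at every point. -/
def IsSkewForm (η : OneForm M) : Prop := ∀ x v, (η x v).swap = -star (η x v)

theorem IsSkewForm.isHermitian {η : OneForm M} (h : IsSkewForm η) (i : σ.ι) (x : M) :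
    (formMatrix σ η i x)ᴴ = formMatrix σ η i x := by
  have h' : ∀ v, (star (η x v)).swap = -η x v := fun v => by
    rw [show (star (η x v)).swap = star (η x v).swap from rfl, h x v, star_neg, star_star]
  rw [conjTranspose_formMatrix]
  simp only [h', rep_neg, Matrix.mul_neg, Finset.sum_neg_distrib, smul_neg, formMatrix, neg_smul]

/-- Independence of the γ^a compares the coefficients on the frame; linearity extends the result to
all tangent vectors. -/
theorem isSkewForm_of_isHermitian {η : OneForm M}
    (h : ∀ x, (formMatrix σ η (σ.at' x) x)ᴴ = formMatrix σ η (σ.at' x) x) : IsSkewForm η := by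
  intro x
  have h₁ := h x
  rw [conjTranspose_formMatrix, formMatrix, neg_smul, ← smul_neg] at h₁
  have h₂ := smul_right_injective _ Complex.I_ne_zero h₁
  have h₃ : ∑ a, onSpin (gam a) * rep ((star (η x (σ.e (σ.at' x) a x))).swap +
      η x (σ.e (σ.at' x) a x)) = 0 := by
    simp only [rep_add, Matrix.mul_add, Finset.sum_add_distrib]
    exact eq_neg_iff_add_eq_zero.1 h₂
  have h₄ := eq_zero_of_sum_gam_mul_rep _ h₃
  have h₅ : ((LinearEquiv.prodComm ℝ ASM ASM).toLinearMap ∘ₗ starₗ) ∘ₗ η x = -η x :=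
    SpinStructure.form_ext (σ.mem_U x) fun a => eq_neg_of_add_eq_zero_left (h₄ a)
  intro v
  have h₆ : (star (η x v)).swap = -η x v := LinearMap.congr_fun h₅ v
  rw [← star_star (η x v).swap, show star (η x v).swap = (star (η x v)).swap from rfl, h₆, star_neg]

end LocalSections

/-! ### Selfadjointness of the operator of a form is a pointwise condition -/

section SelfAdjoint

variable {M : Type*} [TopologicalSpace M] [ChartedSpace E4 M] [IsManifold (𝓡 4) ∞ M]
  {g : Metric4 M} {σ : SpinStructure g}

theorem continuousOn_formMatrix {η : OneForm M} (hη : IsContinuousForm σ η) (i : σ.ι) :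
    ContinuousOn (formMatrix σ η i) (σ.U i) := by
  have hr : Continuous repₗ := LinearMap.continuous_of_finiteDimensional _
  have h : ContinuousOn (fun x => ∑ a, onSpin (gam a) * repₗ (η x (σ.e i a x))) (σ.U i) :=
    continuousOn_finsetSum _ fun a _ => continuousOn_const.mul (hr.comp_continuousOn (hη i a))
  exact h.const_smul (-Complex.I)

/-- The matrix of an operator which is symmetric for the scalar product. -/
theorem isHermitian_of_dotProduct {T : Matrix Idx Idx ℂ}
    (h : ∀ p r : Fibre, star (T *ᵥ p) ⬝ᵥ r = star p ⬝ᵥ (T *ᵥ r)) : Tᴴ = T := by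
  refine Matrix.mulVec_injective (funext fun r => funext fun k => ?_)
  have h₁ := h (Pi.single k 1) r
  rw [Matrix.star_mulVec, ← Matrix.dotProduct_mulVec] at h₁
  have h₂ : star (Pi.single k 1 : Fibre) = Pi.single k 1 := by
    rw [← Pi.single_star, star_one]
  simpa [h₂] using h₁

variable [MeasurableSpace M] [CompactSpace M] [T2Space M]

theorem isSelfAdjointOp_of_isSkewForm {A : SectionOp M} {η : OneForm M}
    (hA : ∀ ψ, IsSmoothSection σ ψ → A ψ = formOp σ η ψ) (hη : IsSkewForm η) :
    IsSelfAdjointOp σ A := by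
  intro ψ χ hψ hχ
  rw [innerL2, innerL2, hA ψ hψ, hA χ hχ]
  congr 1
  funext x
  rw [formOp_apply, formOp_apply, Matrix.star_mulVec, hη.isHermitian, Matrix.dotProduct_mulVec]

variable [BorelSpace M]

/-- If the matrix `T` of the operator were not hermitian at `x₀`, its defect `F` between some
vectors `p`, `r` would be nonzero there. The sections f p and f r, with f a bump function near `x₀`,
would then have inner products that differ by ∫ f² F ≠ 0. -/
theorem isSkewForm_of_isSelfAdjointOp {A : SectionOp M} {η : OneForm M}
    (hA : ∀ ψ, IsSmoothSection σ ψ → A ψ = formOp σ η ψ) (hc : IsContinuousForm σ η)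
    (hs : IsSelfAdjointOp σ A) : IsSkewForm η := by
  refine isSkewForm_of_isHermitian (σ := σ) fun x₀ => isHermitian_of_dotProduct fun p r => ?_
  set i := σ.at' x₀ with hi
  have hx₀ : x₀ ∈ σ.U i := σ.mem_U x₀
  set T := formMatrix σ η i with hT
  have hTc : ContinuousOn T (σ.U i) := continuousOn_formMatrix hc i
  let F : M → ℂ := fun y => star (T y *ᵥ p) ⬝ᵥ r - star p ⬝ᵥ (T y *ᵥ r)
  have hFc : ContinuousOn F (σ.U i) := by
    have h₁ : Continuous fun B : Matrix Idx Idx ℂ => star (B *ᵥ p) ⬝ᵥ r - star p ⬝ᵥ (B *ᵥ r) := by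
      fun_prop
    exact h₁.comp_continuousOn hTc
  by_contra hne
  have hF₀ : F x₀ ≠ 0 := sub_ne_zero.2 hne
  -- Multiplication by the conjugate of F(x₀) rotates the defect so that its real part is positive
  -- at `x₀`, hence near it, and nothing can cancel in the integral.
  let P : M → ℝ := fun y => (star (F x₀) * F y).re
  have hPc : ContinuousOn P (σ.U i) :=
    Complex.continuous_re.comp_continuousOn (continuousOn_const.mul hFc)
  have hP₀ : 0 < P x₀ := by
    have : P x₀ = Complex.normSq (F x₀) := by
      simp [P, Complex.normSq_apply]
    rw [this]
    exact Complex.normSq_pos.2 hF₀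
  have hV : σ.U i ∩ P ⁻¹' Set.Ioi 0 ∈ nhds x₀ :=
    (hPc.isOpen_inter_preimage (σ.isOpen_U i) isOpen_Ioi).mem_nhds ⟨hx₀, hP₀⟩
  obtain ⟨f, hfV, -⟩ := (SmoothBumpFunction.nhds_basis_support (I := 𝓡 4) hV).mem_iff.1 hV
  have hfU : tsupport f ⊆ σ.U i := fun y hy => (hfV hy).1
  let ψ := localSection σ i f p
  let χ := localSection σ i f r
  have hψ : IsSmoothSection σ ψ := isSmoothSection_localSection i f.contMDiff hfU p
  have hχ : IsSmoothSection σ χ := isSmoothSection_localSection i f.contMDiff hfU r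
  have hzero : ∀ y ∉ σ.U i, f y = 0 := fun y hy =>
    image_eq_zero_of_notMem_tsupport fun h => hy (hfU h)
  let a : M → ℂ := fun y => ((f y * f y : ℝ) : ℂ) * (star (T y *ᵥ p) ⬝ᵥ r)
  let b : M → ℂ := fun y => ((f y * f y : ℝ) : ℂ) * (star p ⬝ᵥ (T y *ᵥ r))
  have ha : ∀ y, star (A ψ y) ⬝ᵥ χ y = a y := by
    intro y
    by_cases hy : y ∈ σ.U i
    · rw [hA ψ hψ, star_dotProduct_eq (σ := σ) _ _ i, localRep_formOp η ψ hy,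
        localRep_localSection_self _ _ _ hy, localRep_localSection_self _ _ _ hy]
      simp only [Matrix.mulVec_smul, star_smul, star_trivial, smul_dotProduct, dotProduct_smul,
        Complex.real_smul, a, Complex.ofReal_mul]
      ring
    · simp [a, hzero y hy, χ, localSection]
  have hb : ∀ y, star (ψ y) ⬝ᵥ A χ y = b y := by
    intro y
    by_cases hy : y ∈ σ.U i
    · rw [hA χ hχ, star_dotProduct_eq (σ := σ) _ _ i, localRep_formOp η χ hy,
        localRep_localSection_self _ _ _ hy, localRep_localSection_self _ _ _ hy]
      simp only [Matrix.mulVec_smul, star_smul, star_trivial, smul_dotProduct, dotProduct_smul,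
        Complex.real_smul, b, Complex.ofReal_mul]
      ring
    · simp [b, hzero y hy, ψ, localSection]
  -- `T` is continuous on `U i` only; the factor f², supported there, extends the integrands
  -- continuously by zero.
  have hcont : ∀ B : M → ℂ, ContinuousOn B (σ.U i) →
      Continuous fun y => ((f y * f y : ℝ) : ℂ) * B y := by
    intro B hB
    have hf : Continuous fun y => ((f y * f y : ℝ) : ℂ) :=
      Complex.continuous_ofReal.comp (f.continuous.mul f.continuous)
    refine (hf.continuousOn.mul hB).continuous_of_tsupport_subset (σ.isOpen_U i) ?_
    refine (closure_mono ?_).trans hfU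
    intro y hy hy0
    exact hy (by simp [hy0])
  have hac : Continuous a := hcont _ (by
    have h₁ : Continuous fun B : Matrix Idx Idx ℂ => star (B *ᵥ p) ⬝ᵥ r := by fun_prop
    exact h₁.comp_continuousOn hTc)
  have hbc : Continuous b := hcont _ (by
    have h₁ : Continuous fun B : Matrix Idx Idx ℂ => star p ⬝ᵥ (B *ᵥ r) := by fun_prop
    exact h₁.comp_continuousOn hTc)
  have hint : ∀ {B : M → ℂ}, Continuous B → Integrable B (riemannianVolume g) := fun hB =>
    hB.integrable_of_hasCompactSupport (HasCompactSupport.of_compactSpace _)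
  have h₁ : ∫ y, a y - b y ∂(riemannianVolume g) = 0 := by
    rw [integral_sub (hint hac) (hint hbc), sub_eq_zero]
    have h := hs ψ χ hψ hχ
    simp only [innerL2, ha, hb] at h
    exact h
  let L : ℂ →L[ℝ] ℝ := Complex.reCLM ∘L (ContinuousLinearMap.mul ℝ ℂ (star (F x₀)))
  have h₂ : ∫ y, L (a y - b y) ∂(riemannianVolume g) = 0 := by
    exact (L.integral_comp_comm (hint (hac.sub hbc))).trans ((congrArg L h₁).trans (map_zero L))
  have h₃ : ∀ y, L (a y - b y) = f y * f y * P y := by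
    intro y
    have : a y - b y = ((f y * f y : ℝ) : ℂ) * F y := (mul_sub _ _ _).symm
    rw [this, ← Complex.real_smul, map_smul]
    rfl
  have h₄ : 0 < ∫ y, L (a y - b y) ∂(riemannianVolume g) := by
    refine Continuous.integral_pos_of_hasCompactSupport_nonneg_nonzero (x := x₀)
      (L.continuous.comp (hac.sub hbc)) (HasCompactSupport.of_compactSpace _) ?_ ?_
    · intro y
      simp only [Pi.zero_apply, h₃]
      by_cases hy : y ∈ tsupport f
      · exact mul_nonneg (mul_self_nonneg _) (hfV hy).2.le
      · simp [image_eq_zero_of_notMem_tsupport hy]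
    · rw [h₃, f.eq_one]
      simpa using hP₀.ne'
  exact h₄.ne' h₂

end SelfAdjoint

/-! ## Gauge transformations -/

section Gauge

variable {M : Type*} [TopologicalSpace M] [ChartedSpace E4 M]

/-- The form `u d(u*)` of a unitary field is antiselfadjoint. -/
theorem star_mul_dForm_star {u : M → ASM × ASM} (hu : InAlg u) (hu₁ : ∀ x, u x * star (u x) = 1)
    (x : M) (v : TangentSpace (𝓡 4) x) :
    star (u x * dForm (star u) x v) = -(u x * dForm (star u) x v) := by
  have h₁ : u * star u = fun _ => 1 := funext hu₁
  have h₂ := dForm_mul hu hu.star x v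
  rw [h₁, dForm_const] at h₂
  rw [star_mul, dForm_star hu, star_star]
  rw [dForm_star hu] at h₂
  exact eq_neg_of_add_eq_zero_right h₂.symm

theorem dForm_smul_const {h : M → ℝ} (hh : ContMDiff (𝓡 4) 𝓘(ℝ, ℝ) ∞ h) (c : ASM × ASM) (x : M)
    (v : TangentSpace (𝓡 4) x) : dForm (fun y => h y • c) x v = dAlong h x v • c := by
  have h₁ := dAlong_linearMap (coord.toLinearMap ∘ₗ LinearMap.toSpanSingleton ℝ (ASM × ASM) c)
    ((hh x).mdifferentiableAt (by simp)) v
  rw [dForm_apply, LinearEquiv.symm_apply_eq]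
  exact h₁

theorem inAlg_smul_const {h : M → ℝ} (hh : ContMDiff (𝓡 4) 𝓘(ℝ, ℝ) ∞ h) (c : ASM × ASM) :
    InAlg (fun y => h y • c) :=
  inAlg_iff.2
    (contMDiff_linearMap (coord.toLinearMap ∘ₗ LinearMap.toSpanSingleton ℝ (ASM × ASM) c) hh)

/-- The form `(-X*, X) dh`. -/
theorem freeForm_smul_const {h : M → ℝ} (hh : ContMDiff (𝓡 4) 𝓘(ℝ, ℝ) ∞ h) (X : ASM) (x : M)
    (v : TangentSpace (𝓡 4) x) :
    freeForm ![fun _ => ((0, -star X) : ASM × ASM), fun _ => (X, 0)]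
      ![fun y => h y • ((1, 0) : ASM × ASM), fun y => h y • ((0, 1) : ASM × ASM)] x v =
      dAlong h x v • ((-star X, X) : ASM × ASM) := by
  simp only [freeForm_apply, Fin.sum_univ_two, Matrix.cons_val_zero, Matrix.cons_val_one,
    dForm_smul_const hh]
  ext1 <;> simp

theorem star_smul_ASM (r : ℝ) (a : ASM) : star (r • a) = r • star a := by
  ext <;> simp

/-- Unimodularity of the test forms used in `commute`: the real parts of -q* and q cancel between
the chiralities, and m is traceless. -/
theorem trace_rep_neg_star {q : ℍ[ℝ]} {m : Matrix (Fin 3) (Fin 3) ℂ} (hm : m.trace = 0) :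
    (rep (-star ((0, q, m) : ASM), ((0, q, m) : ASM))).trace = 0 := by
  have h₁ : (star m).trace = 0 := by
    rw [Matrix.star_eq_conjTranspose, Matrix.trace_conjTranspose, hm, star_zero]
  simp [trace_rep, trace_rightBlock, hm, h₁]

/-- The two halves of `u` agree up to a central unitary constant. -/
def AgreesUpToCenter (u : M → ASM × ASM) : Prop :=
  ∃ Z : ASM, Z * star Z = 1 ∧ (∀ a, Commute Z a) ∧ ∀ x, (u x).2 = Z * (u x).1

/-- With u₂ = Z u₁ one has d(u₂*) = Z* d(u₁*), because Z is constant; being central and unitary, Z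
then cancels against Z* in each term. -/
theorem AgreesUpToCenter.gaugeForm_apply {u : M → ASM × ASM} (h : AgreesUpToCenter u)
    (hu : InAlg u) (η : OneForm M) (x : M) (v : TangentSpace (𝓡 4) x) :
    gaugeForm u η x v =
      ((u x).1 * (dForm (star u) x v).1 + (u x).1 * (η x v).1 * star (u x).1,
        (u x).1 * (dForm (star u) x v).1 + (u x).1 * (η x v).2 * star (u x).1) := by
  obtain ⟨Z, hZ, hc, hu₂⟩ := h
  have hs : ∀ a, Commute (star Z) a := fun a => by
    have h₁ := congrArg star (hc (star a)).eq
    rw [star_mul, star_mul, star_star] at h₁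
    exact h₁.symm
  let L : ASM × ASM →ₗ[ℝ] ASM × ASM :=
    (LinearMap.fst ℝ ASM ASM).prod (LinearMap.mulLeft ℝ (star Z) ∘ₗ LinearMap.fst ℝ ASM ASM)
  have hL : star u = fun y => L (star u y) := by
    funext y
    refine Prod.ext rfl ?_
    change star (u y).2 = star Z * star (u y).1
    rw [hu₂, star_mul, (hs _).eq]
  have hd : (dForm (star u) x v).2 = star Z * (dForm (star u) x v).1 := by
    have h₁ := dForm_linearMap L hu.star x v
    rw [← hL] at h₁
    exact congrArg Prod.snd h₁
  rw [TwistedSM.gaugeForm_apply]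
  refine Prod.ext rfl ?_
  change (u x).2 * (dForm (star u) x v).2 + (u x).2 * (η x v).2 * star (u x).2 = _
  have h₃ : ∀ a b : ASM, Z * a * (star Z * b) = a * b := fun a b => by
    rw [(hc a).eq, mul_assoc, ← mul_assoc Z, hZ, one_mul]
  have h₄ : star (u x).2 = star Z * star (u x).1 := by rw [hu₂, star_mul, (hs _).eq]
  rw [hd, h₄, hu₂, h₃, mul_assoc Z, h₃]

/-- Both halves are transformed by u₁ and u₁ d(u₁*) is antiselfadjoint, so the relation η₂ = -η₁* is
inherited. -/
theorem AgreesUpToCenter.isSkewForm_gaugeForm {u : M → ASM × ASM} (h : AgreesUpToCenter u)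
    (hu : InAlg u) (hu₁ : ∀ x, u x * star (u x) = 1) {η : OneForm M} (hη : IsSkewForm η) :
    IsSkewForm (gaugeForm u η) := by
  intro x v
  have h₁ : star ((u x).1 * (dForm (star u) x v).1) = -((u x).1 * (dForm (star u) x v).1) :=
    congrArg Prod.fst (star_mul_dForm_star hu hu₁ x v)
  have h₂ : (η x v).2 = -star (η x v).1 := congrArg Prod.fst (hη x v)
  have h₃ : star (η x v).2 = -(η x v).1 := by rw [h₂, star_neg, star_star]
  rw [h.gaugeForm_apply hu]
  ext1
  · change _ = -star _
    simp only [Prod.swap_prod_mk, star_add, star_mul, star_star, h₁, h₂, neg_add, neg_neg,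
      mul_neg, neg_mul, mul_assoc]
  · change _ = -star _
    simp only [Prod.swap_prod_mk, star_add, star_mul, star_star, h₁, h₃, neg_add, neg_neg,
      mul_neg, neg_mul, mul_assoc]

theorem AgreesUpToCenter.gaugeForm_congr {u v : M → ASM × ASM} (hu' : AgreesUpToCenter u)
    (hv' : AgreesUpToCenter v) (hu : InAlg u) (hv : InAlg v) (h : ∀ x, (u x).1 = (v x).1)
    (η : OneForm M) : gaugeForm u η = gaugeForm v η := by
  have hd : ∀ x w, (dForm (star u) x w).1 = (dForm (star v) x w).1 := by
    intro x w
    let L : ASM × ASM →ₗ[ℝ] ASM × ASM := (LinearMap.fst ℝ ASM ASM).prod 0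
    have h₁ := dForm_linearMap L hu.star x w
    have h₂ := dForm_linearMap L hv.star x w
    have h₃ : (fun y => L (star u y)) = fun y => L (star v y) :=
      funext fun y => Prod.ext (congrArg star (h y)) rfl
    rw [h₃] at h₁
    have h₄ := congrArg Prod.fst (h₁.symm.trans h₂)
    exact h₄
  funext x
  ext1 w
  rw [hu'.gaugeForm_apply hu, hv'.gaugeForm_apply hv, h, hd]

variable [IsManifold (𝓡 4) ∞ M] {g : Metric4 M} {σ : SpinStructure g}
  [MeasurableSpace M] [BorelSpace M] [CompactSpace M] [T2Space M]

/-- The hypothesis on operators becomes one on forms, to be evaluated at 0 and at (-X*, X) dh. -/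
theorem PreservesSelfAdjointness.isSkewForm {u : M → ASM × ASM} (hu : InAlg u)
    (hP : PreservesSelfAdjointness σ u) {n : ℕ} {a b : Fin n → M → ASM × ASM}
    (ha : ∀ k, InAlg (a k)) (hb : ∀ k, InAlg (b k)) (hs : IsSkewForm (freeForm a b))
    (ht : ∀ x v, (rep (freeForm a b x v)).trace = 0) : IsSkewForm (gaugeForm u (freeForm a b)) := by
  have hA : ∀ ψ, IsSmoothSection σ ψ → formOp σ (freeForm a b) ψ = formOp σ (freeForm a b) ψ :=
    fun _ _ => rfl
  have h := hP (formOp σ (freeForm a b))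
    ⟨n, a, b, ha, hb, fun ψ hψ => (sum_act_twistedComm a hb hψ).symm⟩
    (isSelfAdjointOp_of_isSkewForm hA hs)
    ⟨(freeForm a b).components, (hasComponents_components_iff σ).2 hA, ht⟩
  exact isSkewForm_of_isSelfAdjointOp (fun ψ hψ => gaugeAct_eq hu hA hψ)
    (isContinuousForm_gaugeForm hu (isContinuousForm_freeForm ha hb)) h

/-- If the action of `u` preserves selfadjointness, the two halves of `u d(u*)` agree. -/
theorem PreservesSelfAdjointness.swap_eq {u : M → ASM × ASM} (hu : InAlg u)
    (hu₁ : ∀ x, u x * star (u x) = 1) (hP : PreservesSelfAdjointness σ u) (x : M)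
    (v : TangentSpace (𝓡 4) x) :
    (u x * dForm (star u) x v).swap = u x * dForm (star u) x v := by
  -- The empty sum is the zero 1-form, whose transform is θ = u d(u*). Skewness and θ* = -θ together
  -- say ρ(θ) = θ.
  let a : Fin 0 → M → ASM × ASM := fun k => k.elim0
  have h₀ : ∀ x v, freeForm a a x v = 0 := fun x v => by simp [freeForm_apply]
  have h := hP.isSkewForm hu (a := a) (b := a) (fun k => k.elim0) (fun k => k.elim0)
    (fun x v => by rw [h₀, star_zero, neg_zero]; rfl)
    (fun x v => by rw [h₀, rep_zero, Matrix.trace_zero]) x v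
  rw [gaugeForm_apply, h₀, mul_zero, zero_mul, add_zero, star_mul_dForm_star hu hu₁, neg_neg] at h
  exact h

/-- Skewness of the transform of (-X*, X) dh forces conjugation by u₁ and by u₂ to agree on X. -/
theorem PreservesSelfAdjointness.commute {u : M → ASM × ASM} (hu : InAlg u)
    (hu₁ : ∀ x, u x * star (u x) = 1) (hu₂ : ∀ x, star (u x) * u x = 1)
    (hP : PreservesSelfAdjointness σ u) (x : M) (q : ℍ[ℝ]) {m : Matrix (Fin 3) (Fin 3) ℂ}
    (hm : m.trace = 0) :
    Commute (star (u x).1 * (u x).2) ((0, q, m) : ASM) := by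
  set X : ASM := (0, q, m) with hX
  obtain ⟨h, hh, v, hv⟩ := exists_dAlong_ne_zero (M := M) x
  have hsk := hP.isSkewForm hu
    (a := ![fun _ => ((0, -star X) : ASM × ASM), fun _ => (X, 0)])
    (b := ![fun y => h y • ((1, 0) : ASM × ASM), fun y => h y • ((0, 1) : ASM × ASM)])
    (fun k => by fin_cases k <;> exact inAlg_const _)
    (fun k => by fin_cases k <;> exact inAlg_smul_const hh _)
    (fun x v => by
      rw [freeForm_smul_const hh]
      ext1
      · change dAlong h x v • X = -star (dAlong h x v • -star X)
        rw [star_smul_ASM, star_neg, star_star, smul_neg, neg_neg]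
      · change dAlong h x v • -star X = -star (dAlong h x v • X)
        rw [star_smul_ASM, smul_neg])
    (fun x v => by
      rw [freeForm_smul_const hh, rep_smul, Matrix.trace_smul, trace_rep_neg_star hm, smul_zero])
    x v
  set θ := u x * dForm (star u) x v with hθ
  have hθ₁ : θ.swap = θ := hP.swap_eq hu hu₁ x v
  have hθ₂ : star θ = -θ := star_mul_dForm_star hu hu₁ x v
  -- The term θ is skew by itself and drops out, leaving the condition on the conjugated form;
  -- `dAlong h x v` is nonzero and can be cancelled.
  rw [gaugeForm_apply, freeForm_smul_const hh, ← hθ, Prod.swap_add, hθ₁, star_add, hθ₂, neg_add,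
    neg_neg, add_right_inj] at hsk
  have h₁ : dAlong h x v • ((u x).2 * X * star (u x).2) =
      dAlong h x v • ((u x).1 * X * star (u x).1) := by
    have := congrArg Prod.fst hsk
    simpa [mul_assoc, star_smul_ASM] using this
  have h₂ : (u x).2 * X * star (u x).2 = (u x).1 * X * star (u x).1 := smul_right_injective _ hv h₁
  have e₁ : star (u x).1 * (u x).1 = 1 := congrArg Prod.fst (hu₂ x)
  have e₂ : star (u x).2 * (u x).2 = 1 := congrArg Prod.snd (hu₂ x)
  calc star (u x).1 * (u x).2 * X
      = star (u x).1 * ((u x).2 * X * star (u x).2) * (u x).2 := by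
        simp only [mul_assoc, e₂, mul_one]
    _ = (star (u x).1 * (u x).1) * X * (star (u x).1 * (u x).2) := by
        rw [h₂]; simp only [mul_assoc]
    _ = X * (star (u x).1 * (u x).2) := by rw [e₁, one_mul]

/-- If the action of `u = (u₁, u₂)` preserves selfadjointness, then `u₁* u₂` is constant. -/
theorem PreservesSelfAdjointness.star_mul_eq [PreconnectedSpace M] {u : M → ASM × ASM}
    (hu : InAlg u) (hu' : InAlg fun x => (u x).swap) (hu₁ : ∀ x, u x * star (u x) = 1)
    (hu₂ : ∀ x, star (u x) * u x = 1) (hP : PreservesSelfAdjointness σ u) (x y : M) :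
    star (u x).1 * (u x).2 = star (u y).1 * (u y).2 := by
  -- The field u* ρ(u) = (u₁* u₂, u₂* u₁) has zero differential in both halves.
  refine congrArg Prod.fst (eq_of_dForm_eq_zero (b := star u * fun x => (u x).swap)
    (hu.star.mul hu') (fun x v => ?_) x y)
  have h₁ : dForm (fun x => (u x).swap) x v = (dForm u x v).swap :=
    dForm_linearMap (LinearEquiv.prodComm ℝ ASM ASM).toLinearMap hu x v
  have h₂ : dForm u x v = star (dForm (star u) x v) := by rw [dForm_star hu, star_star]
  have h₃ := congrArg star (hP.swap_eq hu hu₁ x v)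
  -- The adjoint of ρ(θ) = θ: the form (du) u* is invariant under the exchange as well. Combined
  -- with (du) u* = -u d(u*), this makes the two Leibniz terms opposite.
  have h₄ : (dForm u x v).swap * star (u x).swap = dForm u x v * star (u x) := by
    rw [star_mul, ← h₂] at h₃
    rw [← h₃, h₂]
    change (star (dForm (star u) x v) * star (u x)).swap = _
    rw [← star_mul]
    rfl
  have h₅ : star (u x).swap * (u x).swap = 1 := congrArg Prod.swap (hu₂ x)
  have h₆ : (dForm u x v).swap = dForm u x v * star (u x) * (u x).swap := by
    rw [← h₄, mul_assoc, h₅, mul_one]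
  have h₇ := star_mul_dForm_star hu hu₁ x v
  rw [star_mul, ← h₂] at h₇
  rw [dForm_mul hu.star hu', h₁, h₆, h₇]
  simp only [Pi.star_apply, neg_mul, mul_neg, ← mul_assoc, hu₂, one_mul]
  exact neg_add_cancel _

theorem AgreesUpToCenter.preservesSelfAdjointness {u : M → ASM × ASM} (h : AgreesUpToCenter u)
    (hu : InAlg u) (hu₁ : ∀ x, u x * star (u x) = 1) : PreservesSelfAdjointness σ u := by
  intro A hA hs _
  obtain ⟨η, hc, hη⟩ := hA.exists_form
  exact isSelfAdjointOp_of_isSkewForm (fun ψ hψ => gaugeAct_eq hu hη hψ)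
    (h.isSkewForm_gaugeForm hu hu₁ (isSkewForm_of_isSelfAdjointOp hη hc hs))

end Gauge

/-! ### Unitary elements, their derivatives and their central parts -/

section UnitaryElements

variable {M : Type*}

theorem exp_mul_star_exp (t : ℝ) :
    Complex.exp (Complex.I * t) * star (Complex.exp (Complex.I * t)) = 1 := by
  rw [Complex.star_def, ← Complex.exp_conj, ← Complex.exp_add]
  simp

theorem star_exp_mul_exp (t : ℝ) :
    star (Complex.exp (Complex.I * t)) * Complex.exp (Complex.I * t) = 1 := by
  rw [mul_comm, exp_mul_star_exp]

theorem unitaryElt_mul_star {α α' : M → ℝ} {q q' : M → ℍ[ℝ]}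
    {m m' : M → Matrix (Fin 3) (Fin 3) ℂ}
    (uq : ∀ x, q x ∈ unitary ℍ[ℝ]) (uq' : ∀ x, q' x ∈ unitary ℍ[ℝ])
    (um : ∀ x, m x ∈ Matrix.unitaryGroup (Fin 3) ℂ)
    (um' : ∀ x, m' x ∈ Matrix.unitaryGroup (Fin 3) ℂ) (x : M) :
    unitaryElt α α' q q' m m' x * star (unitaryElt α α' q q' m m' x) = 1 :=
  Prod.ext
    (Prod.ext (exp_mul_star_exp _)
      (Prod.ext (Unitary.mul_star_self_of_mem (uq x)) (Unitary.mul_star_self_of_mem (um x))))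
    (Prod.ext (exp_mul_star_exp _)
      (Prod.ext (Unitary.mul_star_self_of_mem (uq' x)) (Unitary.mul_star_self_of_mem (um' x))))

theorem star_mul_unitaryElt {α α' : M → ℝ} {q q' : M → ℍ[ℝ]}
    {m m' : M → Matrix (Fin 3) (Fin 3) ℂ}
    (uq : ∀ x, q x ∈ unitary ℍ[ℝ]) (uq' : ∀ x, q' x ∈ unitary ℍ[ℝ])
    (um : ∀ x, m x ∈ Matrix.unitaryGroup (Fin 3) ℂ)
    (um' : ∀ x, m' x ∈ Matrix.unitaryGroup (Fin 3) ℂ) (x : M) :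
    star (unitaryElt α α' q q' m m' x) * unitaryElt α α' q q' m m' x = 1 :=
  Prod.ext
    (Prod.ext (star_exp_mul_exp _)
      (Prod.ext (Unitary.star_mul_self_of_mem (uq x)) (Unitary.star_mul_self_of_mem (um x))))
    (Prod.ext (star_exp_mul_exp _)
      (Prod.ext (Unitary.star_mul_self_of_mem (uq' x)) (Unitary.star_mul_self_of_mem (um' x))))

/-- The centre of ℂ ⊕ ℍ ⊕ M₃(ℂ) is ℂ ⊕ ℝ ⊕ ℂ, so its unitary elements are Z = (e^{iK}, ε, e^{iθ}).
-/
theorem agreesUpToCenter_unitaryElt {α α' : M → ℝ} {q q' : M → ℍ[ℝ]}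
    {m m' : M → Matrix (Fin 3) (Fin 3) ℂ} {K ε θ : ℝ} (hK : ∀ x, α' x = α x + K)
    (hε : ε = 1 ∨ ε = -1) (hq : ∀ x, q' x = ε • q x)
    (hm : ∀ x, m' x = Complex.exp (Complex.I * θ) • m x) :
    AgreesUpToCenter (unitaryElt α α' q q' m m') := by
  have hε₂ : ε * ε = 1 := by rcases hε with rfl | rfl <;> norm_num
  refine ⟨(Complex.exp (Complex.I * K), ε • (1 : ℍ[ℝ]),
    Complex.exp (Complex.I * θ) • (1 : Matrix (Fin 3) (Fin 3) ℂ)), ?_, fun a => ?_, fun x => ?_⟩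
  · refine Prod.ext (exp_mul_star_exp K) (Prod.ext ?_ ?_)
    · change ε • (1 : ℍ[ℝ]) * star (ε • (1 : ℍ[ℝ])) = 1
      rw [Quaternion.star_smul, star_one, smul_mul_smul_comm, one_mul, hε₂, one_smul]
    · change Complex.exp (Complex.I * θ) • (1 : Matrix (Fin 3) (Fin 3) ℂ) *
        star (Complex.exp (Complex.I * θ) • (1 : Matrix (Fin 3) (Fin 3) ℂ)) = 1
      rw [star_smul, star_one, smul_mul_smul_comm, one_mul, exp_mul_star_exp, one_smul]
  · refine Prod.ext (mul_comm _ _) (Prod.ext ?_ ?_)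
    · change ε • (1 : ℍ[ℝ]) * a.2.1 = a.2.1 * ε • (1 : ℍ[ℝ])
      rw [smul_mul_assoc, mul_smul_comm, one_mul, mul_one]
    · change Complex.exp (Complex.I * θ) • (1 : Matrix (Fin 3) (Fin 3) ℂ) * a.2.2 =
        a.2.2 * Complex.exp (Complex.I * θ) • (1 : Matrix (Fin 3) (Fin 3) ℂ)
      rw [smul_mul_assoc, mul_smul_comm, one_mul, mul_one]
  · refine Prod.ext ?_ (Prod.ext ?_ ?_)
    · change Complex.exp (Complex.I * α' x) =
        Complex.exp (Complex.I * K) * Complex.exp (Complex.I * α x)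
      rw [hK, ← Complex.exp_add]
      congr 1
      push_cast
      ring
    · change q' x = ε • (1 : ℍ[ℝ]) * q x
      rw [hq, smul_mul_assoc, one_mul]
    · change m' x = Complex.exp (Complex.I * θ) • (1 : Matrix (Fin 3) (Fin 3) ℂ) * m x
      rw [hm, smul_mul_assoc, one_mul]

variable [TopologicalSpace M] [ChartedSpace E4 M]

theorem contMDiff_exp {α : M → ℝ} (hα : ContMDiff (𝓡 4) 𝓘(ℝ, ℝ) ∞ α) :
    ContMDiff (𝓡 4) 𝓘(ℝ, ℂ) ∞ (fun x => Complex.exp (Complex.I * α x)) := by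
  have h : ContDiff ℝ ∞ (fun t : ℝ => Complex.exp (Complex.I * t)) :=
    Complex.contDiff_exp.comp (contDiff_const.mul Complex.ofRealCLM.contDiff)
  exact h.contMDiff.comp hα

theorem inAlg_unitaryElt {α α' : M → ℝ} {q q' : M → ℍ[ℝ]} {m m' : M → Matrix (Fin 3) (Fin 3) ℂ}
    (hα : ContMDiff (𝓡 4) 𝓘(ℝ, ℝ) ∞ α) (hα' : ContMDiff (𝓡 4) 𝓘(ℝ, ℝ) ∞ α')
    (hq : ContMDiff (𝓡 4) 𝓘(ℝ, ℍ[ℝ]) ∞ q) (hq' : ContMDiff (𝓡 4) 𝓘(ℝ, ℍ[ℝ]) ∞ q')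
    (hm : ∀ i j, ContMDiff (𝓡 4) 𝓘(ℝ, ℂ) ∞ (fun x => m x i j))
    (hm' : ∀ i j, ContMDiff (𝓡 4) 𝓘(ℝ, ℂ) ∞ (fun x => m' x i j)) :
    InAlg (unitaryElt α α' q q' m m') :=
  ⟨⟨contMDiff_exp hα, hq, hm⟩, ⟨contMDiff_exp hα', hq', hm'⟩⟩

theorem dAlong_star_exp {α : M → ℝ} (hα : ContMDiff (𝓡 4) 𝓘(ℝ, ℝ) ∞ α) (x : M)
    (v : TangentSpace (𝓡 4) x) :
    dAlong (fun y => star (Complex.exp (Complex.I * α y))) x v =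
      -Complex.I * (dAlong α x v : ℝ) * star (Complex.exp (Complex.I * α x)) := by
  have e : ∀ t : ℝ, star (Complex.exp (Complex.I * t)) = Complex.exp (-Complex.I * t) := by
    intro t
    rw [Complex.star_def, ← Complex.exp_conj]
    simp
  simp only [e]
  have h₁ : HasDerivAt (fun t : ℝ => Complex.exp (-Complex.I * t))
      (Complex.exp (-Complex.I * α x) * (-Complex.I * 1)) (α x) :=
    ((Complex.ofRealCLM.hasDerivAt (x := α x)).const_mul (-Complex.I)).cexp
  have h₂ := h₁.hasFDerivAt.hasMFDerivAt.comp x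
    ((hα x).mdifferentiableAt (by simp)).hasMFDerivAt
  have h₃ : dAlong (fun y => Complex.exp (-Complex.I * α y)) x v =
      (dAlong α x v : ℝ) • (Complex.exp (-Complex.I * α x) * (-Complex.I * 1)) :=
    congrArg (fun T => T v) h₂.mfderiv
  rw [h₃, Complex.real_smul]
  ring

/-- The abelian part of `u d(u*)`. -/
theorem exp_mul_dAlong_star_exp {α : M → ℝ} (hα : ContMDiff (𝓡 4) 𝓘(ℝ, ℝ) ∞ α) (x : M)
    (v : TangentSpace (𝓡 4) x) :
    Complex.exp (Complex.I * α x) * dAlong (fun y => star (Complex.exp (Complex.I * α y))) x v =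
      -(Complex.I * (dAlong α x v : ℝ)) := by
  rw [dAlong_star_exp hα]
  linear_combination (-(Complex.I * (dAlong α x v : ℝ))) * exp_mul_star_exp (α x)

theorem dForm_star_unitaryElt {α α' : M → ℝ} {q q' : M → ℍ[ℝ]}
    {m m' : M → Matrix (Fin 3) (Fin 3) ℂ} (hu : InAlg (unitaryElt α α' q q' m m')) (x : M)
    (v : TangentSpace (𝓡 4) x) :
    dForm (star (unitaryElt α α' q q' m m')) x v =
      ((dAlong (fun y => star (Complex.exp (Complex.I * α y))) x v,
        dAlong (fun y => star (q y)) x v, dMatrix (fun y => star (m y)) x v),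
       (dAlong (fun y => star (Complex.exp (Complex.I * α' y))) x v,
        dAlong (fun y => star (q' y)) x v, dMatrix (fun y => star (m' y)) x v)) := by
  let p₁ := LinearMap.fst ℝ ASM ASM
  let p₂ := LinearMap.snd ℝ ASM ASM
  let c := LinearMap.fst ℝ ℂ (ℍ[ℝ] × Matrix (Fin 3) (Fin 3) ℂ)
  let r := LinearMap.fst ℝ ℍ[ℝ] (Matrix (Fin 3) (Fin 3) ℂ) ∘ₗ
    LinearMap.snd ℝ ℂ (ℍ[ℝ] × Matrix (Fin 3) (Fin 3) ℂ)
  let s := LinearMap.snd ℝ ℍ[ℝ] (Matrix (Fin 3) (Fin 3) ℂ) ∘ₗ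
    LinearMap.snd ℝ ℂ (ℍ[ℝ] × Matrix (Fin 3) (Fin 3) ℂ)
  refine Prod.ext (Prod.ext ?_ (Prod.ext ?_ ?_)) (Prod.ext ?_ (Prod.ext ?_ ?_))
  · exact map_dForm (c ∘ₗ p₁) hu.star x v
  · exact map_dForm (r ∘ₗ p₁) hu.star x v
  · ext i j
    exact map_dForm (Matrix.entryLinearMap ℝ ℂ i j ∘ₗ s ∘ₗ p₁) hu.star x v
  · exact map_dForm (c ∘ₗ p₂) hu.star x v
  · exact map_dForm (r ∘ₗ p₂) hu.star x v
  · ext i j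
    exact map_dForm (Matrix.entryLinearMap ℝ ℂ i j ∘ₗ s ∘ₗ p₂) hu.star x v

theorem eq_one_or_eq_neg_one_of_commute {s : ℍ[ℝ]} (hs : ∀ q, Commute s q)
    (hu : s * star s = 1) : ∃ ε : ℝ, (ε = 1 ∨ ε = -1) ∧ s = ε • (1 : ℍ[ℝ]) := by
  obtain ⟨i, hi⟩ : ∃ i : ℍ[ℝ], i = ⟨0, 1, 0, 0⟩ := ⟨_, rfl⟩
  obtain ⟨j, hj⟩ : ∃ j : ℍ[ℝ], j = ⟨0, 0, 1, 0⟩ := ⟨_, rfl⟩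
  -- Commuting with i kills the j and k parts, commuting with j kills the i part.
  have h₁ := congrArg (fun z : ℍ[ℝ] => z.imK) (hs i).eq
  have h₂ := congrArg (fun z : ℍ[ℝ] => z.imJ) (hs i).eq
  have h₃ := congrArg (fun z : ℍ[ℝ] => z.imK) (hs j).eq
  simp only [Quaternion.imJ_mul, Quaternion.imK_mul] at h₁ h₂ h₃
  simp only [hi, hj] at h₁ h₂ h₃
  have hJ : s.imJ = 0 := by linarith
  have hK : s.imK = 0 := by linarith
  have hI : s.imI = 0 := by linarith
  refine ⟨s.re, ?_, ?_⟩
  · have h₄ := congrArg (fun z : ℍ[ℝ] => z.re) hu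
    simp [hI, hJ, hK] at h₄
    exact mul_self_eq_one_iff.1 h₄
  · ext <;> simp [hI, hJ, hK]

theorem eq_exp_smul_one_of_commute {n : Matrix (Fin 3) (Fin 3) ℂ}
    (hn : ∀ a : Matrix (Fin 3) (Fin 3) ℂ, a.trace = 0 → Commute n a) (hu : n * star n = 1) :
    ∃ θ : ℝ, n = Complex.exp (Complex.I * θ) • (1 : Matrix (Fin 3) (Fin 3) ℂ) := by
  -- Off-diagonal matrix units are traceless, and commuting with them already forces a scalar
  -- matrix; the restriction to traceless m therefore costs nothing.
  obtain ⟨c, hc⟩ := Matrix.mem_range_scalar_of_commute_single (M := n) fun i j hij =>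
    (hn _ (Matrix.trace_single_eq_of_ne i j 1 hij)).symm
  have hc' : n = c • (1 : Matrix (Fin 3) (Fin 3) ℂ) := by
    rw [← hc, Matrix.smul_one_eq_diagonal]
    rfl
  have h₁ : c * star c = 1 := by
    rw [hc', star_smul, star_one, smul_mul_smul_comm, one_mul] at hu
    simpa using congrFun (congrFun hu 0) 0
  have h₂ : ‖c‖ = 1 := by
    have h₃ := congrArg norm h₁
    rw [norm_mul, norm_star, norm_one] at h₃
    exact (mul_self_eq_one_iff.1 h₃).resolve_right (by linarith [norm_nonneg c])
  refine ⟨c.arg, ?_⟩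
  rw [hc']
  congr 1
  conv_lhs => rw [← Complex.norm_mul_exp_arg_mul_I c, h₂]
  simp [mul_comm]

end UnitaryElements

theorem dAlong_sub {M : Type*} [TopologicalSpace M] [ChartedSpace E4 M] {f h : M → ℝ}
    (hf : ContMDiff (𝓡 4) 𝓘(ℝ, ℝ) ∞ f) (hh : ContMDiff (𝓡 4) 𝓘(ℝ, ℝ) ∞ h) (x : M)
    (v : TangentSpace (𝓡 4) x) :
    dAlong (fun y => f y - h y) x v = dAlong f x v - dAlong h x v :=
  congrArg (fun T => T v) (mfderiv_sub ((hf x).mdifferentiableAt (by simp))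
    ((hh x).mdifferentiableAt (by simp)))

/-- Unitary elements that preserve selfadjointness have halves that agree up to constants. -/
theorem PreservesSelfAdjointness.exists_constants {M : Type*} [TopologicalSpace M]
    [ChartedSpace E4 M] [IsManifold (𝓡 4) ∞ M] [CompactSpace M] [T2Space M] [ConnectedSpace M]
    [MeasurableSpace M] [BorelSpace M] {g : Metric4 M} {σ : SpinStructure g}
    {α α' : M → ℝ} {q q' : M → ℍ[ℝ]} {m m' : M → Matrix (Fin 3) (Fin 3) ℂ}
    (hα : ContMDiff (𝓡 4) 𝓘(ℝ, ℝ) ∞ α) (hα' : ContMDiff (𝓡 4) 𝓘(ℝ, ℝ) ∞ α')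
    (hu : InAlg (unitaryElt α α' q q' m m'))
    (uq : ∀ x, q x ∈ unitary ℍ[ℝ]) (uq' : ∀ x, q' x ∈ unitary ℍ[ℝ])
    (um : ∀ x, m x ∈ Matrix.unitaryGroup (Fin 3) ℂ)
    (um' : ∀ x, m' x ∈ Matrix.unitaryGroup (Fin 3) ℂ)
    (hP : PreservesSelfAdjointness σ (unitaryElt α α' q q' m m')) :
    (∃ K : ℝ, ∀ x, α' x = α x + K) ∧
      (∃ ε : ℝ, (ε = 1 ∨ ε = -1) ∧ ∀ x, q' x = ε • q x) ∧
      (∃ θ : ℝ, ∀ x, m' x = Complex.exp (Complex.I * θ) • m x) := by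
  set u := unitaryElt α α' q q' m m' with hu_def
  have hu₁ := unitaryElt_mul_star (α := α) (α' := α') uq uq' um um'
  have hu₂ := star_mul_unitaryElt (α := α) (α' := α') uq uq' um um'
  have hu' : InAlg fun x => (u x).swap := ⟨hu.2, hu.1⟩
  obtain ⟨x₀⟩ := (inferInstance : Nonempty M)
  have hconst : ∀ x, star (u x).1 * (u x).2 = star (u x₀).1 * (u x₀).2 := fun x =>
    hP.star_mul_eq hu hu' hu₁ hu₂ x x₀
  refine ⟨?_, ?_, ?_⟩
  · have hd : ∀ x v, dAlong (fun y => α' y - α y) x v = 0 := by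
      intro x v
      have h := congrArg (fun a : ASM × ASM => a.1.1) (hP.swap_eq hu hu₁ x v)
      rw [hu_def, dForm_star_unitaryElt hu] at h
      change Complex.exp (Complex.I * α' x) *
          dAlong (fun y => star (Complex.exp (Complex.I * α' y))) x v =
        Complex.exp (Complex.I * α x) *
          dAlong (fun y => star (Complex.exp (Complex.I * α y))) x v at h
      rw [exp_mul_dAlong_star_exp hα', exp_mul_dAlong_star_exp hα, neg_inj] at h
      rw [dAlong_sub hα' hα, sub_eq_zero]
      exact Complex.ofReal_injective (mul_left_cancel₀ Complex.I_ne_zero h)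
    refine ⟨α' x₀ - α x₀, fun x => ?_⟩
    have := eq_of_dAlong_eq_zero (hα'.sub hα) hd x x₀
    linarith
  · have hs : star (q x₀) * q' x₀ * star (star (q x₀) * q' x₀) = 1 := by
      rw [star_mul, star_star, mul_assoc, ← mul_assoc (q' x₀),
        Unitary.mul_star_self_of_mem (uq' x₀), one_mul, Unitary.star_mul_self_of_mem (uq x₀)]
    -- The test element is X = (0, p, 0); one base point is enough, since u₁* u₂ is constant.
    obtain ⟨ε, hε, h⟩ := eq_one_or_eq_neg_one_of_commute (fun p =>
      congrArg (fun a : ASM => a.2.1)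
        (hP.commute hu hu₁ hu₂ x₀ p (Matrix.trace_zero (Fin 3) ℂ)).eq) hs
    refine ⟨ε, hε, fun x => ?_⟩
    have h₁ : star (q x) * q' x = ε • (1 : ℍ[ℝ]) :=
      (congrArg (fun a : ASM => a.2.1) (hconst x)).trans h
    rw [← one_mul (q' x), ← Unitary.mul_star_self_of_mem (uq x), mul_assoc, h₁, mul_smul_comm,
      mul_one]
  · have hs : star (m x₀) * m' x₀ * star (star (m x₀) * m' x₀) = 1 := by
      rw [star_mul, star_star, mul_assoc, ← mul_assoc (m' x₀),
        Unitary.mul_star_self_of_mem (um' x₀), one_mul, Unitary.star_mul_self_of_mem (um x₀)]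
    obtain ⟨θ, h⟩ := eq_exp_smul_one_of_commute (fun p hp =>
      congrArg (fun a : ASM => a.2.2) (hP.commute hu hu₁ hu₂ x₀ 0 hp).eq) hs
    refine ⟨θ, fun x => ?_⟩
    have h₁ : star (m x) * m' x = Complex.exp (Complex.I * θ) • 1 :=
      (congrArg (fun a : ASM => a.2.2) (hconst x)).trans h
    rw [← one_mul (m' x), ← Unitary.mul_star_self_of_mem (um x), mul_assoc, h₁, mul_smul_comm,
      mul_one]

end TwistedSM

/-! ### Assembly of the three claims -/

theorem mainTheorem6 {M : Type*} [TopologicalSpace M] [ChartedSpace TwistedSM.E4 M]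
    [IsManifold (𝓡 4) ∞ M] [CompactSpace M] [T2Space M] [ConnectedSpace M]
    [MeasurableSpace M] [BorelSpace M]
    (g : TwistedSM.Metric4 M) (σ : TwistedSM.SpinStructure g)
    (α α' : M → ℝ) (q q' : M → ℍ[ℝ]) (m m' : M → Matrix (Fin 3) (Fin 3) ℂ)
    (hα : ContMDiff (𝓡 4) 𝓘(ℝ, ℝ) ∞ α) (hα' : ContMDiff (𝓡 4) 𝓘(ℝ, ℝ) ∞ α')
    (hq : ContMDiff (𝓡 4) 𝓘(ℝ, ℍ[ℝ]) ∞ q) (hq' : ContMDiff (𝓡 4) 𝓘(ℝ, ℍ[ℝ]) ∞ q')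
    (hm : ∀ i j, ContMDiff (𝓡 4) 𝓘(ℝ, ℂ) ∞ (fun x => m x i j))
    (hm' : ∀ i j, ContMDiff (𝓡 4) 𝓘(ℝ, ℂ) ∞ (fun x => m' x i j))
    (uq : ∀ x, q x ∈ unitary ℍ[ℝ]) (uq' : ∀ x, q' x ∈ unitary ℍ[ℝ])
    (um : ∀ x, m x ∈ Matrix.unitaryGroup (Fin 3) ℂ)
    (um' : ∀ x, m' x ∈ Matrix.unitaryGroup (Fin 3) ℂ) :
    (TwistedSM.PreservesSelfAdjointness σ (TwistedSM.unitaryElt α α' q q' m m') ↔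
      (∃ K : ℝ, ∀ x, α' x = α x + K) ∧
      (∃ ε : ℝ, (ε = 1 ∨ ε = -1) ∧ ∀ x, q' x = ε • q x) ∧
      (∃ θ : ℝ, ∀ x, m' x = Complex.exp (Complex.I * θ) • m x)) ∧
    (TwistedSM.PreservesSelfAdjointness σ (TwistedSM.unitaryElt α α' q q' m m') →
      (∀ A : TwistedSM.SectionOp M, TwistedSM.IsFreeOneForm σ A →
        ∀ ψ, TwistedSM.IsSmoothSection σ ψ →
          TwistedSM.gaugeAct σ (TwistedSM.unitaryElt α α' q q' m m') A ψ =
            TwistedSM.gaugeAct σ (TwistedSM.unitaryElt α α' q q m m) A ψ) ∧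
      (∀ A : TwistedSM.SectionOp M, TwistedSM.IsFreeOneForm σ A →
        TwistedSM.IsSelfAdjointOp σ A → TwistedSM.IsUnimodular σ A →
        (∃ w, TwistedSM.HasComponents σ A w) ∧
        (∃ w', TwistedSM.HasComponents σ
          (TwistedSM.gaugeAct σ (TwistedSM.unitaryElt α α' q q' m m') A) w') ∧
        ∀ w w' : TwistedSM.Components M, TwistedSM.HasComponents σ A w →
          TwistedSM.HasComponents σ
            (TwistedSM.gaugeAct σ (TwistedSM.unitaryElt α α' q q' m m') A) w' →
          ∀ (x : M) (v : TangentSpace (𝓡 4) x),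
            w'.cr x v = w.cr x v - Complex.I * (TwistedSM.dAlong α x v : ℝ) ∧
            w'.cl x v = w.cl x v - Complex.I * (TwistedSM.dAlong α x v : ℝ) ∧
            w'.qr x v = q x * w.qr x v * star (q x)
              + q x * TwistedSM.dAlong (fun y => star (q y)) x v ∧
            w'.ql x v = q x * w.ql x v * star (q x)
              + q x * TwistedSM.dAlong (fun y => star (q y)) x v ∧
            w'.mr x v = m x * w.mr x v * star (m x)
              + m x * TwistedSM.dMatrix (fun y => star (m y)) x v ∧
            w'.ml x v = m x * w.ml x v * star (m x)
              + m x * TwistedSM.dMatrix (fun y => star (m y)) x v)) := by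
  have hu := TwistedSM.inAlg_unitaryElt hα hα' hq hq' hm hm'
  have hu₁ := TwistedSM.unitaryElt_mul_star (α := α) (α' := α') uq uq' um um'
  have hconst : TwistedSM.PreservesSelfAdjointness σ (TwistedSM.unitaryElt α α' q q' m m') → _ :=
    fun hP => hP.exists_constants hα hα' hu uq uq' um um'
  refine ⟨⟨hconst, fun ⟨⟨K, hK⟩, ⟨ε, hε, hqq⟩, θ, hmm⟩ =>
    (TwistedSM.agreesUpToCenter_unitaryElt hK hε hqq hmm).preservesSelfAdjointness hu hu₁⟩,
    fun hP => ?_⟩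
  obtain ⟨⟨K, hK⟩, ⟨ε, hε, hqq⟩, θ, hmm⟩ := hconst hP
  have hZ := TwistedSM.agreesUpToCenter_unitaryElt hK hε hqq hmm
  refine ⟨fun A hA ψ hψ => ?_, fun A hA _ _ => ?_⟩
  · obtain ⟨η, -, hη⟩ := hA.exists_form
    have hv := TwistedSM.inAlg_unitaryElt hα hα' hq hq hm hm
    -- The comparison element has the same first half and the same K, with trivial ε and θ.
    have hZ' : TwistedSM.AgreesUpToCenter (TwistedSM.unitaryElt α α' q q m m) :=
      TwistedSM.agreesUpToCenter_unitaryElt (ε := 1) (θ := 0) hK (Or.inl rfl)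
        (fun x => (one_smul _ _).symm) (fun x => by simp)
    rw [TwistedSM.gaugeAct_eq hu hη hψ, TwistedSM.gaugeAct_eq hv hη hψ,
      hZ.gaugeForm_congr hZ' hu hv fun _ => rfl]
  · obtain ⟨η, -, hη⟩ := hA.exists_form
    have hη' : ∀ ψ, TwistedSM.IsSmoothSection σ ψ →
        TwistedSM.gaugeAct σ (TwistedSM.unitaryElt α α' q q' m m') A ψ =
          TwistedSM.formOp σ (TwistedSM.gaugeForm (TwistedSM.unitaryElt α α' q q' m m') η) ψ :=
      fun ψ hψ => TwistedSM.gaugeAct_eq hu hη hψ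
    refine ⟨⟨_, (TwistedSM.hasComponents_components_iff σ).2 hη⟩,
      ⟨_, (TwistedSM.hasComponents_components_iff σ).2 hη'⟩, fun w w' hw hw' x v => ?_⟩
    rw [TwistedSM.hasComponents_iff] at hw hw'
    -- Forms are determined by their operators, so arbitrary components `w` and `w'` are those of η
    -- and of its gauge transform.
    have e : w.form = η :=
      TwistedSM.form_eq_of_formOp_eq fun ψ hψ => (hw ψ hψ).symm.trans (hη ψ hψ)
    have e' : w'.form = TwistedSM.gaugeForm (TwistedSM.unitaryElt α α' q q' m m') η :=
      TwistedSM.form_eq_of_formOp_eq fun ψ hψ => (hw' ψ hψ).symm.trans (hη' ψ hψ)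
    have key := hZ.gaugeForm_apply hu w.form x v
    rw [e, ← e', ← e, TwistedSM.dForm_star_unitaryElt hu] at key
    have hexp := TwistedSM.exp_mul_dAlong_star_exp hα x v
    -- In the commutative part conjugation is trivial and only the inhomogeneous term -i dα remains.
    have hc : ∀ c : ℂ, Complex.exp (Complex.I * α x) *
          TwistedSM.dAlong (fun y => star (Complex.exp (Complex.I * α y))) x v +
        Complex.exp (Complex.I * α x) * c * star (Complex.exp (Complex.I * α x)) =
        c - Complex.I * (TwistedSM.dAlong α x v : ℝ) := by
      intro c
      rw [hexp]
      linear_combination c * TwistedSM.exp_mul_star_exp (α x)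
    -- The fields q^r and q^l are read off from the second and the first half respectively, opposite
    -- to c and m.
    refine ⟨?_, ?_, ?_, ?_, ?_, ?_⟩
    · exact (congrArg (fun a => a.1.1) key).trans (hc _)
    · exact (congrArg (fun a => a.2.1) key).trans (hc _)
    · exact (congrArg (fun a => a.2.2.1) key).trans (add_comm _ _)
    · exact (congrArg (fun a => a.1.2.1) key).trans (add_comm _ _)
    · exact (congrArg (fun a => a.1.2.2) key).trans (add_comm _ _)
    · exact (congrArg (fun a => a.2.2.2) key).trans (add_comm _ _)
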